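/- Let $Y$ and $Y^\diamond$ be real Banach spaces forming a norming dual pair: there is a bilinear map $\langle\cdot,\cdot\rangle : Y^\diamond\times Y\to\mathbb R$ and $M\in[1,\infty)$ with $|\langle y^\diamond,y\rangle|\le M\|y^\diamond\|\,\|y\|$, $\|y\|=\sup\{|\langle y^\diamond,y\rangle| : \|y^\diamond\|\le1\}$ and $\|y^\diamond\|=\sup\{|\langle y^\diamond,y\rangle| : \|y\|\le1\}$. Let $\sigma(Y,Y^\diamond)$ and $\sigma(Y^\diamond,Y)$ be the weak topologies induced by the pairing. Assume that the pair is suitable for twin perturbation, that is: (a) $(Y,\sigma(Y,Y^\diamond))$ is sequentially complete, or every sequentially continuous linear functional on $(Y^\diamond,\sigma(Y^\diamond,Y))$ is continuous; and (b) $(Y^\diamond,\sigma(Y^\diamond,Y))$ is sequentially complete, or every sequentially continuous linear functional on $(Y,\sigma(Y,Y^\diamond))$ is continuous. A twin operator $L$ is a bounded bilinear form $(y^\diamond,y)\mapsto y^\diamond Ly$ on $Y^\diamond\times Y$ that is $\sigma(Y^\diamond,Y)$-continuous in $y^\diamond$ and $\sigma(Y,Y^\diamond)$-continuous in $y$; then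 there are $Ly\in Y$ and $y^\diamond L\in Y^\diamond$ with $\langle y^\diamond,Ly\rangle=y^\diamond Ly=\langle y^\diamond L,y\rangle$, and twin operators are composed by $y^\diamond L_1L_2y=\langle y^\diamond L_1,L_2y\rangle$. A twin semigroup is a family $\{S(t)\}_{t\ge0}$ of twin operators such that (i) $S(0)=I$ and $S(t+s)=S(t)S(s)$ for $t,s\ge0$; (ii) for some $M\ge1$ and $\omega\in\mathbb R$, $|y^\diamond S(t)y|\le Me^{\omega t}\|y\|\,\|y^\diamond\|$ for all $t\ge0$, $y$, $y^\diamond$; (iii) $t\mapsto y^\diamond S(t)y$ is Borel measurable for all $y,y^\diamond$; (iv) for each $\lambda\in\mathbb C$ with $\mathrm{Re}\,\lambda>\omega$ there is a twin operator $\overline S(\lambda)$ (on the complexified pair; equivalently, its real and imaginary parts are twin operators on $(Y,Y^\diamond)$) with $y^\diamond\overline S(\lambda)y=\int_0^\infty e^{-\lambda t}\,y^\diamond S(t)y\,dt$. Its generator is the possibly multi-valued operator $C=\lambda I-\overline S(\lambda)^{-1}$ on $Y$, i.e. $z\in Cy$ if and only if $y=\overline S(\lambda)(\lambda y-z)$ for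 some real $\lambda>\omega$ with $\omega$ as in (ii). **Theorem 5.1.** Let $\{S_0(t)\}$ be a twin semigroup on $(Y,Y^\diamond)$ with generator $C_0$, and let $q_1,\dots,q_n\in Y$ and $q_1^\diamond,\dots,q_n^\diamond\in Y^\diamond$. Put $k_{ij}(t)=q_i^\diamond S_0(t)q_j$ for $t\ge0$. There is a unique locally bounded measurable $r:[0,\infty)\to\mathbb R^{n\times n}$, the resolvent of $k$, with $$k+k*r=r=k+r*k,\qquad (f*g)(t)=\int_0^tf(t-\tau)g(\tau)\,d\tau .$$ For $y\in Y$, $y^\diamond\in Y^\diamond$ and $t\ge0$ define $$v_i(t)y=q_i^\diamond S_0(t)y+\int_0^t\sum_{j=1}^n r_{ij}(t-\tau)\,q_j^\diamond S_0(\tau)y\,d\tau,\qquad y^\diamond w_j(t)=y^\diamond S_0(t)q_j+\int_0^t\sum_{i=1}^n y^\diamond S_0(t-\tau)q_i\;r_{ij}(\tau)\,d\tau .$$ Then $$y^\diamond S_0(t)y+\int_0^t\sum_{j=1}^n y^\diamond S_0(t-\tau)q_j\;v_j(\tau)y\,d\tau \;=\; y^\diamond S_0(t)y+\int_0^t\sum_{j=1}^n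 y^\diamond w_j(t-\tau)\;q_j^\diamond S_0(\tau)y\,d\tau ,$$ and if $y^\diamond S(t)y$ denotes this common value, then $\{S(t)\}_{t\ge0}$ is a twin semigroup on $(Y,Y^\diamond)$, whose generator $C$ is $$\mathcal D(C)=\mathcal D(C_0),\qquad Cy=C_0y+\sum_{j=1}^n\langle q_j^\diamond,y\rangle\,q_j .$$ -/

import Mathlib

open scoped NNReal Topology
open Filter

noncomputable section

/-- A norming dual pair of (real) Banach spaces `(Y, Yd)`, where `Yd` plays the role of `Y^⋄`. -/
structure NormingDualPair (Y Yd : Type*) [NormedAddCommGroup Y] [NormedSpace ℝ Y]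
    [NormedAddCommGroup Yd] [NormedSpace ℝ Yd] where
  /-- the bilinear pairing `⟨y^⋄, y⟩` -/
  pairing : Yd →ₗ[ℝ] Y →ₗ[ℝ] ℝ
  bounded : ∃ M : ℝ, 1 ≤ M ∧ ∀ yd y, |pairing yd y| ≤ M * ‖yd‖ * ‖y‖
  norm_isLUB : ∀ y : Y, IsLUB {a : ℝ | ∃ yd : Yd, ‖yd‖ ≤ 1 ∧ a = |pairing yd y|} ‖y‖
  dual_norm_isLUB : ∀ yd : Yd, IsLUB {a : ℝ | ∃ y : Y, ‖y‖ ≤ 1 ∧ a = |pairing yd y|} ‖yd‖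

namespace NormingDualPair

variable {Y Yd : Type*} [NormedAddCommGroup Y] [NormedSpace ℝ Y]
  [NormedAddCommGroup Yd] [NormedSpace ℝ Yd]

/-- `(Y, σ(Y, Y^⋄))`: the space `Y` with the weak topology generated by `Y^⋄`. -/
abbrev Weak (P : NormingDualPair Y Yd) := WeakBilin P.pairing.flip

/-- `(Y^⋄, σ(Y^⋄, Y))`: the space `Y^⋄` with the weak topology generated by `Y`. -/
abbrev WeakDiamond (P : NormingDualPair Y Yd) := WeakBilin P.pairing

end NormingDualPair

/-- Every Cauchy sequence of the topological vector space `E` converges. -/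
def TVSSequentiallyComplete (E : Type*) [AddCommGroup E] [TopologicalSpace E] : Prop :=
  ∀ u : ℕ → E, Tendsto (fun p : ℕ × ℕ => u p.1 - u p.2) atTop (𝓝 0) →
    ∃ x : E, Tendsto u atTop (𝓝 x)

/-- Every sequentially continuous linear functional on `E` is continuous. -/
def SeqContinuousFunctionalsContinuous (E : Type*) [AddCommGroup E] [Module ℝ E]
    [TopologicalSpace E] : Prop :=
  ∀ f : E →ₗ[ℝ] ℝ, SeqContinuous f → Continuous f

/-- The norming dual pair is suitable for twin perturbation. -/
def NormingDualPair.SuitableForTwinPerturbation {Y Yd : Type*} [NormedAddCommGroup Y]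
    [NormedSpace ℝ Y] [NormedAddCommGroup Yd] [NormedSpace ℝ Yd]
    (P : NormingDualPair Y Yd) : Prop :=
  (TVSSequentiallyComplete P.Weak ∨ SeqContinuousFunctionalsContinuous P.WeakDiamond) ∧
  (TVSSequentiallyComplete P.WeakDiamond ∨ SeqContinuousFunctionalsContinuous P.Weak)

/-- A twin operator: a bounded bilinear form on `Y^⋄ × Y` that is weakly continuous in each of
its two arguments. -/
structure TwinOperator {Y Yd : Type*} [NormedAddCommGroup Y] [NormedSpace ℝ Y]
    [NormedAddCommGroup Yd] [NormedSpace ℝ Yd] (P : NormingDualPair Y Yd) where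
  /-- the bilinear form `(y^⋄, y) ↦ y^⋄ L y` -/
  form : Yd →ₗ[ℝ] Y →ₗ[ℝ] ℝ
  bounded : ∃ K : ℝ, 0 < K ∧ ∀ yd y, |form yd y| ≤ K * ‖yd‖ * ‖y‖
  continuous_diamond : ∀ y : Y, Continuous fun yd : P.WeakDiamond => form yd y
  continuous_state : ∀ yd : Yd, Continuous fun y : P.Weak => form yd y

namespace TwinOperator

variable {Y Yd : Type*} [NormedAddCommGroup Y] [NormedSpace ℝ Y]
  [NormedAddCommGroup Yd] [NormedSpace ℝ Yd] {P : NormingDualPair Y Yd}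

theorem exists_act (L : TwinOperator P) (y : Y) :
    ∃ z : Y, ∀ yd : Yd, P.pairing yd z = L.form yd y := by
  obtain ⟨z, hz⟩ := LinearMap.dualEmbedding_surjective P.pairing
    ⟨(L.form.flip y : Yd →ₗ[ℝ] ℝ), L.continuous_diamond y⟩
  exact ⟨z, fun yd => DFunLike.congr_fun hz yd⟩

theorem exists_coact (L : TwinOperator P) (yd : Yd) :
    ∃ zd : Yd, ∀ y : Y, P.pairing zd y = L.form yd y := by
  obtain ⟨z, hz⟩ := LinearMap.dualEmbedding_surjective P.pairing.flip
    ⟨(L.form yd : Y →ₗ[ℝ] ℝ), L.continuous_state yd⟩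
  exact ⟨z, fun y => DFunLike.congr_fun hz y⟩

/-- The action of a twin operator on `Y`: the element `L y`. -/
def act (L : TwinOperator P) (y : Y) : Y := (L.exists_act y).choose

/-- The action of a twin operator on `Y^⋄`: the element `y^⋄ L`. -/
def coact (L : TwinOperator P) (yd : Yd) : Yd := (L.exists_coact yd).choose

theorem pairing_act (L : TwinOperator P) (yd : Yd) (y : Y) :
    P.pairing yd (L.act y) = L.form yd y := (L.exists_act y).choose_spec yd

theorem pairing_coact (L : TwinOperator P) (yd : Yd) (y : Y) :
    P.pairing (L.coact yd) y = L.form yd y := (L.exists_coact yd).choose_spec y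

end TwinOperator

section Semigroups

variable {Y Yd : Type*} [NormedAddCommGroup Y] [NormedSpace ℝ Y]
  [NormedAddCommGroup Yd] [NormedSpace ℝ Yd] {P : NormingDualPair Y Yd}

/-- The estimate `|y^⋄ S(t) y| ≤ M e^{ω t} ‖y‖ ‖y^⋄‖`, with `M ≥ 1`. -/
def HasGrowthBound (S : ℝ≥0 → TwinOperator P) (M ω : ℝ) : Prop :=
  1 ≤ M ∧ ∀ (t : ℝ≥0) (yd : Yd) (y : Y),
    |(S t).form yd y| ≤ M * Real.exp (ω * t) * ‖y‖ * ‖yd‖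

/-- `R + i J` is the Laplace transform of `S` at the complex number `z`. (A twin operator on the
complexified pair is determined by its real and imaginary parts, which are twin operators.) -/
def IsComplexLaplaceTransform (S : ℝ≥0 → TwinOperator P) (z : ℂ) (R J : TwinOperator P) : Prop :=
  ∀ (yd : Yd) (y : Y), (R.form yd y : ℂ) + Complex.I * (J.form yd y : ℂ) =
    ∫ t in Set.Ioi (0 : ℝ), Complex.exp (-z * t) * ((S t.toNNReal).form yd y : ℂ)

/-- `R` is the Laplace transform of `S` at the real number `l`. -/
def IsLaplaceTransform (S : ℝ≥0 → TwinOperator P) (l : ℝ) (R : TwinOperator P) : Prop :=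
  ∀ (yd : Yd) (y : Y), R.form yd y =
    ∫ t in Set.Ioi (0 : ℝ), Real.exp (-l * t) * (S t.toNNReal).form yd y

/-- Twin semigroups on a norming dual pair. -/
structure IsTwinSemigroup (S : ℝ≥0 → TwinOperator P) : Prop where
  map_zero : ∀ (yd : Yd) (y : Y), (S 0).form yd y = P.pairing yd y
  map_add : ∀ (t s : ℝ≥0) (yd : Yd) (y : Y),
    (S (t + s)).form yd y = P.pairing ((S t).coact yd) ((S s).act y)
  measurable : ∀ (yd : Yd) (y : Y), Measurable fun t : ℝ≥0 => (S t).form yd y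
  growth_and_laplace : ∃ M ω : ℝ, HasGrowthBound S M ω ∧
    ∀ z : ℂ, ω < z.re → ∃ R J : TwinOperator P, IsComplexLaplaceTransform S z R J

/-- The generator `C = l I - S̄(l)⁻¹` of a twin semigroup, as a multi-valued operator on `Y`:
the graph consists of all `(y, z)` with `y = S̄(l) (l y - z)`, where `l` is a real number larger
than an exponential growth bound of `S` and `S̄(l)` is the Laplace transform of `S` at `l`. -/
def generatorGraph (S : ℝ≥0 → TwinOperator P) : Set (Y × Y) :=
  {p | ∃ (M ω l : ℝ) (R : TwinOperator P), HasGrowthBound S M ω ∧ ω < l ∧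
    IsLaplaceTransform S l R ∧ p.1 = R.act (l • p.1 - p.2)}

/-- The graph of `C₀ + ∑ j, ⟨q_j^⋄, ·⟩ q_j` on the domain of the multi-valued operator `C₀`. -/
def finiteRankPerturbation (P : NormingDualPair Y Yd) (C₀ : Set (Y × Y)) {n : ℕ}
    (q : Fin n → Y) (qd : Fin n → Yd) : Set (Y × Y) :=
  {p | ∃ z : Y, (p.1, z) ∈ C₀ ∧ p.2 = z + ∑ j, P.pairing (qd j) p.1 • q j}

/-- Convolution `(f * g)(t) = ∫₀ᵗ f(t - τ) g(τ) dτ` of functions on `[0, ∞)`. -/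
def convolve (f g : ℝ≥0 → ℝ) (t : ℝ≥0) : ℝ :=
  ∫ τ in (0 : ℝ)..(t : ℝ), f ((t : ℝ) - τ).toNNReal * g τ.toNNReal

/-- Convolution of matrix valued functions on `[0, ∞)`. -/
def matrixConvolve {n : ℕ} (k r : ℝ≥0 → Matrix (Fin n) (Fin n) ℝ) (t : ℝ≥0) :
    Matrix (Fin n) (Fin n) ℝ :=
  Matrix.of fun i j => ∑ l, convolve (fun τ => k τ i l) (fun τ => r τ l j) t

/-- `r` is a resolvent of the kernel `k`: a measurable, locally bounded solution of
`k + k * r = r = k + r * k` on `[0, ∞)`. -/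
structure IsResolventKernel {n : ℕ} (k r : ℝ≥0 → Matrix (Fin n) (Fin n) ℝ) : Prop where
  measurable : ∀ i j, Measurable fun t => r t i j
  locallyBounded : ∀ T : ℝ≥0, ∃ K : ℝ, ∀ t ≤ T, ∀ i j, |r t i j| ≤ K
  eq_left : ∀ t, r t = k t + matrixConvolve k r t
  eq_right : ∀ t, r t = k t + matrixConvolve r k t

/-- The kernel `k_ij(t) = q_i^⋄ S₀(t) q_j`. -/
def perturbationKernel (S₀ : ℝ≥0 → TwinOperator P) {n : ℕ} (q : Fin n → Y) (qd : Fin n → Yd)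
    (t : ℝ≥0) : Matrix (Fin n) (Fin n) ℝ :=
  Matrix.of fun i j => (S₀ t).form (qd i) (q j)

/-- The `i`-th component of `v(t)y = q^⋄ S₀(t) y + ∫₀ᵗ r(t - τ) q^⋄ S₀(τ) y dτ`. -/
def outputFunction (S₀ : ℝ≥0 → TwinOperator P) {n : ℕ} (qd : Fin n → Yd)
    (r : ℝ≥0 → Matrix (Fin n) (Fin n) ℝ) (y : Y) (i : Fin n) (t : ℝ≥0) : ℝ :=
  (S₀ t).form (qd i) y +
    ∑ j, convolve (fun τ => r τ i j) (fun τ => (S₀ τ).form (qd j) y) t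

/-- The `j`-th component of `y^⋄ w(t) = y^⋄ S₀(t) q + ∫₀ᵗ y^⋄ S₀(t - τ) q r(τ) dτ`. -/
def inputFunction (S₀ : ℝ≥0 → TwinOperator P) {n : ℕ} (q : Fin n → Y)
    (r : ℝ≥0 → Matrix (Fin n) (Fin n) ℝ) (yd : Yd) (j : Fin n) (t : ℝ≥0) : ℝ :=
  (S₀ t).form yd (q j) +
    ∑ i, convolve (fun τ => (S₀ τ).form yd (q i)) (fun τ => r τ i j) t

/-- `y^⋄ S₀(t) y + ∫₀ᵗ y^⋄ S₀(t - τ) q · v(τ)y dτ`. -/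
def perturbedForm (S₀ : ℝ≥0 → TwinOperator P) {n : ℕ} (q : Fin n → Y) (qd : Fin n → Yd)
    (r : ℝ≥0 → Matrix (Fin n) (Fin n) ℝ) (t : ℝ≥0) (yd : Yd) (y : Y) : ℝ :=
  (S₀ t).form yd y +
    ∑ j, convolve (fun τ => (S₀ τ).form yd (q j)) (outputFunction S₀ qd r y j) t

/-- `y^⋄ S₀(t) y + ∫₀ᵗ y^⋄ w(t - τ) · q^⋄ S₀(τ) y dτ`. -/
def perturbedFormDual (S₀ : ℝ≥0 → TwinOperator P) {n : ℕ} (q : Fin n → Y) (qd : Fin n → Yd)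
    (r : ℝ≥0 → Matrix (Fin n) (Fin n) ℝ) (t : ℝ≥0) (yd : Yd) (y : Y) : ℝ :=
  (S₀ t).form yd y +
    ∑ j, convolve (inputFunction S₀ q r yd j) (fun τ => (S₀ τ).form (qd j) y) t

end Semigroups

end

/-!
The proof of the perturbation theorem rests on four observations.

*Convolution algebra.* Locally bounded measurable functions on `[0, ∞)` form a commutative ring
without unit under convolution. Uniqueness of the resolvent, solvability of Volterra equations, and
the equality of the two formulas for `y^⋄ S(t) y` are then identities between matrices over this ring
(`LocallyBoundedMeasurable.resolvent_unique`, `LocallyBoundedMeasurable.volterra_unique`,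
`IsTwinSemigroup.perturbedForm_eq_dual`). The resolvent exists as a Neumann series: with respect to
the weight `e^{at}`, `a` large, convolution with the kernel is a contraction, which also gives
an exponential bound (`LocallyBoundedMeasurable.exists_resolvent`).

*Weak integrals stay in the spaces.* For a twin semigroup the functional
`y^⋄ ↦ ∫₀^∞ e^{-lt} y^⋄ S₀(t) q dt` is represented by an element of `Y` for every large `l`. The
functions `e^{-lt} p(e^{-t})`, `p` a polynomial, are dense in the weighted `L¹` space in which these
integrals depend continuously on the weight, uniformly for bounded `y^⋄`; since `Y` is complete and
embeds isometrically into the dual of `Y^⋄`, the functional `y^⋄ ↦ ∫ g(t) y^⋄ S₀(t) q dt` is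
represented in `Y` for all weights `g` in that space
(`NormingDualPair.exists_pairing_eq_integral`). Hence the first formula for `y^⋄ S(t) y` is weakly
continuous in `y^⋄`, and by symmetry the second one is weakly continuous in `y`.

*Semigroup law.* The function `v(t) y` satisfies `v_i(t) y = q_i^⋄ S(t) y`. Splitting the convolution
at `s` shows that `t ↦ v(t + s) y` solves the Volterra equation that characterizes
`t ↦ v(t) S(s) y`, so both agree (`IsTwinSemigroup.perturbedForm_add`).

*Generator.* Laplace transforms turn the two formulas into
`R y = R₀ y + ∑ ⟨q_j^⋄, R y⟩ R₀ q_j = R₀ y + ∑ ⟨q_j^⋄, R₀ y⟩ R q_j` for the transforms `R₀`, `R` of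
`S₀`, `S`. These show that the transforms of `S` are twin operators, and they convert
`y = R (l y - z)` into `y = R₀ (l y - z₀)` with `z = z₀ + ∑ ⟨q_j^⋄, y⟩ q_j` and conversely. The
resolvent identity makes the graph of a generator independent of `l`
(`IsTwinSemigroup.eq_act_of_mem_generatorGraph`), so that one `l` serves both semigroups.
-/

open MeasureTheory

noncomputable section

/-! ### The convolution ring of locally bounded measurable functions -/

/-- The additive group of Borel measurable, locally bounded functions on `[0, ∞)`. Multiplication is
convolution, see the ring structure below; kernels, resolvents and orbits of twin semigroups are
(matrices of) elements of it. -/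
def LocallyBoundedMeasurable : AddSubgroup (ℝ≥0 → ℝ) where
  carrier := {f | Measurable f ∧ ∀ T : ℝ≥0, ∃ K : ℝ, ∀ t ≤ T, |f t| ≤ K}
  zero_mem' := ⟨measurable_const, fun _ => ⟨0, fun t _ => by simp⟩⟩
  add_mem' := by
    rintro f g ⟨hf, hf'⟩ ⟨hg, hg'⟩
    refine ⟨hf.add hg, fun T => ?_⟩
    obtain ⟨K, hK⟩ := hf' T
    obtain ⟨K', hK'⟩ := hg' T
    exact ⟨K + K', fun t ht => (abs_add_le _ _).trans (add_le_add (hK t ht) (hK' t ht))⟩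
  neg_mem' := by
    rintro f ⟨hf, hf'⟩
    exact ⟨hf.neg, fun T => (hf' T).imp fun K hK t ht => by simpa using hK t ht⟩

namespace LocallyBoundedMeasurable

theorem abs_mem {f : ℝ≥0 → ℝ} (hf : f ∈ LocallyBoundedMeasurable) :
    (fun t => |f t|) ∈ LocallyBoundedMeasurable :=
  ⟨hf.1.abs, fun T => (hf.2 T).imp fun K hK t ht => by simpa using hK t ht⟩

theorem exists_bound {f : ℝ≥0 → ℝ} (hf : f ∈ LocallyBoundedMeasurable) (T : ℝ≥0) :
    ∃ K : ℝ, 0 ≤ K ∧ ∀ t ≤ T, |f t| ≤ K := by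
  obtain ⟨K, hK⟩ := hf.2 T
  exact ⟨K, (abs_nonneg _).trans (hK 0 zero_le), hK⟩

end LocallyBoundedMeasurable

/-! ### Convolution on the half-line -/

/-- The extension by zero to the real line of a function on `[0, ∞)`. -/
def extendByZero (f : ℝ≥0 → ℝ) : ℝ → ℝ :=
  (Set.Ici (0 : ℝ)).indicator fun x => f x.toNNReal

theorem extendByZero_coe (f : ℝ≥0 → ℝ) (t : ℝ≥0) : extendByZero f t = f t := by
  simp [extendByZero]

theorem extendByZero_of_neg (f : ℝ≥0 → ℝ) {x : ℝ} (hx : x < 0) : extendByZero f x = 0 := by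
  simp [extendByZero, hx]

theorem extendByZero_of_nonneg (f : ℝ≥0 → ℝ) {x : ℝ} (hx : 0 ≤ x) :
    extendByZero f x = f x.toNNReal := by
  simp [extendByZero, hx]

theorem norm_extendByZero (f : ℝ≥0 → ℝ) :
    (fun x => ‖extendByZero f x‖) = extendByZero fun t => |f t| := by
  ext x
  rcases lt_or_ge x 0 with hx | hx
  · simp [extendByZero_of_neg _ hx]
  · simp [extendByZero_of_nonneg _ hx]

theorem measurable_extendByZero {f : ℝ≥0 → ℝ} (hf : Measurable f) :
    Measurable (extendByZero f) :=
  (hf.comp measurable_real_toNNReal).indicator measurableSet_Ici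

theorem exists_abs_extendByZero_le {f : ℝ≥0 → ℝ} (hf : f ∈ LocallyBoundedMeasurable) (x : ℝ) :
    ∃ K : ℝ, 0 ≤ K ∧ ∀ y ≤ x, |extendByZero f y| ≤ K := by
  obtain ⟨K, hK0, hK⟩ := LocallyBoundedMeasurable.exists_bound hf x.toNNReal
  refine ⟨K, hK0, fun y hy => ?_⟩
  rcases lt_or_ge y 0 with h | h
  · simpa [extendByZero_of_neg _ h] using hK0
  · rw [extendByZero_of_nonneg _ h]
    exact hK _ (Real.toNNReal_le_toNNReal hy)

theorem integrable_extendByZero_mul {f g : ℝ≥0 → ℝ} (hf : f ∈ LocallyBoundedMeasurable)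
    (hg : g ∈ LocallyBoundedMeasurable) (x : ℝ) :
    Integrable fun y => extendByZero f y * extendByZero g (x - y) := by
  obtain ⟨K, hK0, hK⟩ := exists_abs_extendByZero_le hf x
  obtain ⟨K', hK0', hK'⟩ := exists_abs_extendByZero_le hg x
  have hi : Integrable ((Set.Icc (0 : ℝ) x).indicator fun _ => K * K') := by
    rw [integrable_indicator_iff measurableSet_Icc]
    exact integrableOn_const (by simp)
  refine hi.mono' ((measurable_extendByZero hf.1).mul ((measurable_extendByZero hg.1).comp
    (measurable_const.sub measurable_id))).aestronglyMeasurable (Eventually.of_forall fun y => ?_)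
  by_cases hy : y ∈ Set.Icc 0 x
  · rw [Set.indicator_of_mem hy, norm_mul]
    exact mul_le_mul (hK y hy.2) (hK' _ (by linarith [hy.1])) (norm_nonneg _) hK0
  · rw [Set.indicator_of_notMem hy]
    rcases lt_or_ge y 0 with h | h
    · simp [extendByZero_of_neg _ h]
    · have : x - y < 0 := by
        by_contra h'
        exact hy ⟨h, by linarith⟩
      simp [extendByZero_of_neg _ this]

/-- Convolution on the half-line is convolution on the line of the extensions by zero. -/
theorem convolution_extendByZero (f g : ℝ≥0 → ℝ) :
    convolution (extendByZero f) (extendByZero g) (ContinuousLinearMap.mul ℝ ℝ) volume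
      = extendByZero (convolve f g) := by
  ext x
  rw [convolution_eq_swap]
  have key : ∀ y, extendByZero f (x - y) * extendByZero g y =
      (Set.Icc 0 x).indicator (fun y => f (x - y).toNNReal * g y.toNNReal) y := by
    intro y
    by_cases hy : y ∈ Set.Icc 0 x
    · rw [Set.indicator_of_mem hy, extendByZero_of_nonneg _ hy.1,
        extendByZero_of_nonneg _ (sub_nonneg.2 hy.2)]
    · rw [Set.indicator_of_notMem hy]
      rcases lt_or_ge y 0 with h | h
      · simp [extendByZero_of_neg _ h]
      · have : x - y < 0 := by
          by_contra h'
          exact hy ⟨h, by linarith⟩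
        simp [extendByZero_of_neg _ this]
  simp only [ContinuousLinearMap.mul_apply', key]
  rw [integral_indicator measurableSet_Icc]
  rcases lt_or_ge x 0 with h | h
  · simp [extendByZero_of_neg _ h, Set.Icc_eq_empty (not_le.2 h)]
  · rw [extendByZero_of_nonneg _ h, convolve, Real.coe_toNNReal _ h,
      intervalIntegral.integral_of_le h, integral_Icc_eq_integral_Ioc]

theorem convolve_eq_convolution (f g : ℝ≥0 → ℝ) (t : ℝ≥0) :
    convolve f g t =
      convolution (extendByZero f) (extendByZero g) (ContinuousLinearMap.mul ℝ ℝ) volume t := by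
  rw [convolution_extendByZero, extendByZero_coe]

theorem convolve_eq_integral (f g : ℝ≥0 → ℝ) (t : ℝ≥0) :
    convolve f g t = ∫ τ, extendByZero f τ * extendByZero g (t - τ) := by
  rw [convolve_eq_convolution]; rfl

theorem convolve_comm (f g : ℝ≥0 → ℝ) : convolve f g = convolve g f := by
  ext t
  rw [convolve_eq_convolution, convolve_eq_convolution, ← convolution_flip]
  congr 1
  ext
  simp

theorem convolve_mem {f g : ℝ≥0 → ℝ} (hf : f ∈ LocallyBoundedMeasurable)
    (hg : g ∈ LocallyBoundedMeasurable) : convolve f g ∈ LocallyBoundedMeasurable := by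
  constructor
  · have h : Measurable (fun p : ℝ≥0 × ℝ => extendByZero f p.2 * extendByZero g (p.1 - p.2)) :=
      ((measurable_extendByZero hf.1).comp measurable_snd).mul
        ((measurable_extendByZero hg.1).comp
          ((measurable_coe_nnreal_real.comp measurable_fst).sub measurable_snd))
    have := (h.stronglyMeasurable.integral_prod_right' (ν := (volume : Measure ℝ))).measurable
    exact (funext (convolve_eq_integral f g)) ▸ this
  · intro T
    obtain ⟨K, hK0, hK⟩ := LocallyBoundedMeasurable.exists_bound hf T
    obtain ⟨K', hK0', hK'⟩ := LocallyBoundedMeasurable.exists_bound hg T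
    refine ⟨K * K' * T, fun t ht => ?_⟩
    have h := intervalIntegral.norm_integral_le_of_norm_le_const (a := 0) (b := (t : ℝ))
      (f := fun τ : ℝ => f ((t : ℝ) - τ).toNNReal * g τ.toNNReal) (C := K * K') (by
        intro τ hτ
        rw [Set.uIoc_of_le t.coe_nonneg] at hτ
        rw [norm_mul]
        refine mul_le_mul (hK _ (le_trans ?_ ht)) (hK' _ (le_trans ?_ ht)) (norm_nonneg _) hK0
        · exact Real.toNNReal_le_iff_le_coe.2 (by linarith [hτ.1])
        · exact Real.toNNReal_le_iff_le_coe.2 hτ.2)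
    refine h.trans ?_
    rw [sub_zero, abs_of_nonneg t.coe_nonneg]
    exact mul_le_mul_of_nonneg_left (by exact_mod_cast ht) (mul_nonneg hK0 hK0')

/-- Fubini's theorem; its integrability hypotheses hold because the convolutions of the absolute
values are again locally bounded. -/
theorem convolve_assoc {f g h : ℝ≥0 → ℝ} (hf : f ∈ LocallyBoundedMeasurable)
    (hg : g ∈ LocallyBoundedMeasurable) (hh : h ∈ LocallyBoundedMeasurable) :
    convolve (convolve f g) h = convolve f (convolve g h) := by
  ext t
  rw [convolve_eq_convolution, convolve_eq_convolution, ← convolution_extendByZero,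
    ← convolution_extendByZero]
  refine convolution_assoc _ _ _ _ (fun x y z => by simp [mul_assoc])
    (measurable_extendByZero hf.1).aestronglyMeasurable
    (measurable_extendByZero hg.1).aestronglyMeasurable
    (measurable_extendByZero hh.1).aestronglyMeasurable
    (Eventually.of_forall fun x => integrable_extendByZero_mul hf hg x)
    (Eventually.of_forall fun x => ?_) ?_
  · rw [norm_extendByZero, norm_extendByZero]
    exact integrable_extendByZero_mul (LocallyBoundedMeasurable.abs_mem hg)
      (LocallyBoundedMeasurable.abs_mem hh) x
  · rw [norm_extendByZero, norm_extendByZero, norm_extendByZero, convolution_extendByZero]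
    exact integrable_extendByZero_mul (LocallyBoundedMeasurable.abs_mem hf)
      (convolve_mem (LocallyBoundedMeasurable.abs_mem hg)
        (LocallyBoundedMeasurable.abs_mem hh)) t

theorem convolve_add {f g h : ℝ≥0 → ℝ} (hf : f ∈ LocallyBoundedMeasurable)
    (hg : g ∈ LocallyBoundedMeasurable) (hh : h ∈ LocallyBoundedMeasurable) :
    convolve f (g + h) = convolve f g + convolve f h := by
  ext t
  rw [Pi.add_apply, convolve_eq_integral, convolve_eq_integral, convolve_eq_integral,
    ← integral_add (integrable_extendByZero_mul hf hg t) (integrable_extendByZero_mul hf hh t)]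
  congr 1
  ext τ
  rw [← mul_add]
  congr 1
  rcases lt_or_ge ((t : ℝ) - τ) 0 with h | h
  · simp [extendByZero_of_neg _ h]
  · simp [extendByZero_of_nonneg _ h]

theorem convolve_zero (f : ℝ≥0 → ℝ) : convolve f 0 = 0 := by
  ext t
  simp [convolve]

/-- Locally bounded measurable functions on `[0, ∞)` form a commutative ring (without unit) under
pointwise addition and convolution. -/
instance : NonUnitalCommRing LocallyBoundedMeasurable where
  __ := (inferInstance : AddCommGroup LocallyBoundedMeasurable)
  mul f g := ⟨convolve f g, convolve_mem f.2 g.2⟩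
  mul_comm f g := Subtype.ext (convolve_comm _ _)
  mul_assoc f g h := Subtype.ext (convolve_assoc f.2 g.2 h.2)
  left_distrib f g h := Subtype.ext (convolve_add f.2 g.2 h.2)
  right_distrib f g h := Subtype.ext (by
    change convolve (f.1 + g.1) h.1 = convolve f.1 h.1 + convolve g.1 h.1
    rw [convolve_comm, convolve_add h.2 f.2 g.2, convolve_comm, convolve_comm h.1])
  zero_mul f := Subtype.ext (by
    change convolve 0 f.1 = 0
    rw [convolve_comm, convolve_zero])
  mul_zero f := Subtype.ext (convolve_zero _)

namespace LocallyBoundedMeasurable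

theorem mul_apply (f g : LocallyBoundedMeasurable) (t : ℝ≥0) :
    (f * g).1 t = convolve f.1 g.1 t := rfl

theorem sum_apply {ι : Type*} (s : Finset ι) (f : ι → LocallyBoundedMeasurable) (t : ℝ≥0) :
    (∑ i ∈ s, f i).1 t = ∑ i ∈ s, (f i).1 t := by
  rw [AddSubgroup.val_finsetSum, Finset.sum_apply]

theorem matrix_mul_apply {l m o : Type*} [Fintype m] (A : Matrix l m LocallyBoundedMeasurable)
    (B : Matrix m o LocallyBoundedMeasurable) (i : l) (j : o) (t : ℝ≥0) :
    ((A * B) i j).1 t = ∑ k, convolve (A i k).1 (B k j).1 t := by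
  rw [Matrix.mul_apply, sum_apply]
  rfl

/-- Two-sided resolvents in a non-unital ring are unique. -/
theorem resolvent_unique {m : Type*} [Fintype m]
    {k r r' : Matrix m m LocallyBoundedMeasurable}
    (h : r = k + r * k) (h' : r' = k + k * r') : r = r' := by
  have h1 : r * r' = r * k + r * (k * r') := by
    conv_lhs => rw [h', mul_add]
  have h2 : r * r' = k * r' + r * (k * r') := by
    conv_lhs => rw [h, add_mul, mul_assoc]
  have h3 : r * k = k * r' := add_right_cancel (h1.symm.trans h2)
  rw [h, h', h3]

/-- The linear Volterra equation `u = a + k * u` has the unique solution `u = a + r * a`. -/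
theorem volterra_unique {m o : Type*} [Fintype m]
    {k r : Matrix m m LocallyBoundedMeasurable} {a u : Matrix m o LocallyBoundedMeasurable}
    (h : r = k + r * k) (hu : u = a + k * u) : u = a + r * a := by
  have h1 : r * u = r * a + (r * k) * u := by
    conv_lhs => rw [hu, Matrix.mul_add, ← Matrix.mul_assoc]
  have h2 : r * u = k * u + (r * k) * u := by
    conv_lhs => rw [h, Matrix.add_mul]
  have h3 : r * a = k * u := add_right_cancel (h1.symm.trans h2)
  rw [h3, ← hu]

end LocallyBoundedMeasurable

/-! ### Exponential bounds and existence of resolvents -/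

/-- Strict inequality of the rates avoids a factor `t`, and the constant is small for large `a`. -/
theorem abs_convolve_le_exp {f g : ℝ≥0 → ℝ} {A B ω a : ℝ} (ha : ω < a)
    (hf : ∀ t, |f t| ≤ A * Real.exp (ω * t)) (hg : ∀ t, |g t| ≤ B * Real.exp (a * t)) (t : ℝ≥0) :
    |convolve f g t| ≤ A * B / (a - ω) * Real.exp (a * t) := by
  have hA : 0 ≤ A := by simpa using (abs_nonneg _).trans (hf 0)
  have hB : 0 ≤ B := by simpa using (abs_nonneg _).trans (hg 0)
  have hd : 0 < a - ω := sub_pos.2 ha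
  have h := intervalIntegral.norm_integral_le_of_norm_le (a := 0) (b := (t : ℝ)) (μ := volume)
    (f := fun τ : ℝ => f ((t : ℝ) - τ).toNNReal * g τ.toNNReal)
    (g := fun τ => A * B * Real.exp (ω * t) * Real.exp ((a - ω) * τ)) t.2
    (Eventually.of_forall fun τ hτ => by
      rw [norm_mul]
      refine (mul_le_mul (hf _) (hg _) (abs_nonneg _) (by positivity)).trans (le_of_eq ?_)
      rw [Real.coe_toNNReal _ (sub_nonneg.2 hτ.2), Real.coe_toNNReal _ hτ.1.le,
        mul_mul_mul_comm, ← Real.exp_add, mul_assoc (A * B), ← Real.exp_add]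
      congr 2
      ring)
    (Continuous.intervalIntegrable (by fun_prop) _ _)
  refine h.trans ?_
  rw [intervalIntegral.integral_const_mul,
    intervalIntegral.integral_comp_mul_left (fun x => Real.exp x) hd.ne', integral_exp,
    mul_zero, Real.exp_zero, smul_eq_mul]
  have h2 : Real.exp (a * t) = Real.exp (ω * t) * Real.exp ((a - ω) * t) := by
    rw [← Real.exp_add]
    congr 1
    ring
  rw [h2, div_eq_mul_inv]
  have h3 : 0 ≤ A * B * Real.exp (ω * t) * (a - ω)⁻¹ := by positivity
  nlinarith [h3]

/-- Convolution with `f` commutes with series that converge in an exponentially weighted norm. -/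
theorem hasSum_convolve {f : ℝ≥0 → ℝ} {g : ℕ → ℝ≥0 → ℝ} {c : ℕ → ℝ} {a : ℝ}
    (hf : f ∈ LocallyBoundedMeasurable) (hg : ∀ m, Measurable (g m)) (hc : Summable c)
    (hgc : ∀ m t, |g m t| ≤ c m * Real.exp (a * t)) (t : ℝ≥0) :
    HasSum (fun m => convolve f (g m) t) (convolve f (fun s => ∑' m, g m s) t) := by
  obtain ⟨K, hK0, hK⟩ := LocallyBoundedMeasurable.exists_bound hf t
  have hc0 : ∀ m, 0 ≤ c m := fun m => by simpa using (abs_nonneg _).trans (hgc m 0)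
  refine intervalIntegral.hasSum_integral_of_dominated_convergence
    (fun m _ => K * (c m * Real.exp (|a| * t))) (fun m => ?_) (fun m => ?_) ?_ ?_ ?_
  · exact ((hf.1.comp (measurable_real_toNNReal.comp (measurable_const.sub measurable_id))).mul
      ((hg m).comp measurable_real_toNNReal)).aestronglyMeasurable
  · refine Eventually.of_forall fun τ hτ => ?_
    rw [Set.uIoc_of_le t.coe_nonneg] at hτ
    rw [norm_mul]
    refine mul_le_mul (hK _ ?_) ((hgc m _).trans ?_) (norm_nonneg _) hK0
    · exact Real.toNNReal_le_iff_le_coe.2 (by linarith [hτ.1])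
    · refine mul_le_mul_of_nonneg_left (Real.exp_le_exp.2 ?_) (hc0 m)
      rw [Real.coe_toNNReal _ hτ.1.le]
      exact mul_le_mul (le_abs_self a) hτ.2 hτ.1.le (abs_nonneg a)
  · exact Eventually.of_forall fun τ _ => (hc.mul_right _).mul_left _
  · simp
  · refine Eventually.of_forall fun τ _ => HasSum.mul_left _ (Summable.hasSum ?_)
    exact Summable.of_norm_bounded (hc.mul_right _) fun m => hgc m _

theorem tsum_mem_locallyBoundedMeasurable {g : ℕ → ℝ≥0 → ℝ} {c : ℕ → ℝ} {a : ℝ}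
    (hg : ∀ m, Measurable (g m)) (hc : Summable c)
    (hgc : ∀ m t, |g m t| ≤ c m * Real.exp (a * t)) :
    (∀ t, |∑' m, g m t| ≤ (∑' m, c m) * Real.exp (a * t)) ∧
    (fun t => ∑' m, g m t) ∈ LocallyBoundedMeasurable := by
  have hs : ∀ t, Summable fun m => g m t := fun t =>
    Summable.of_norm_bounded (hc.mul_right (Real.exp (a * t))) fun m => hgc m t
  have hb : ∀ t, |∑' m, g m t| ≤ (∑' m, c m) * Real.exp (a * t) := fun t => by
    rw [← tsum_mul_right]
    exact tsum_of_norm_bounded (f := fun m => g m t) (hc.mul_right _).hasSum fun m => hgc m t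
  have hc0 : ∀ m, 0 ≤ c m := fun m => by simpa using (abs_nonneg _).trans (hgc m 0)
  refine ⟨hb, ?_, fun T => ⟨(∑' m, c m) * Real.exp (|a| * T), fun t ht => (hb t).trans ?_⟩⟩
  · refine measurable_of_tendsto_metrizable (f := fun N t => ∑ m ∈ Finset.range N, g m t)
      (fun N => Finset.measurable_fun_sum _ fun m _ => hg m)
      (tendsto_pi_nhds.2 fun t => (hs t).hasSum.tendsto_sum_nat)
  · refine mul_le_mul_of_nonneg_left (Real.exp_le_exp.2 ?_) (tsum_nonneg hc0)
    exact mul_le_mul (le_abs_self a) (by exact_mod_cast ht) t.coe_nonneg (abs_nonneg a)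

namespace LocallyBoundedMeasurable

variable {m : Type*} [Fintype m]

/-- The terms `k, k * k, k * k * k, …` of the Neumann series of the resolvent. -/
def neumannTerm (k : Matrix m m LocallyBoundedMeasurable) :
    ℕ → Matrix m m LocallyBoundedMeasurable
  | 0 => k
  | N + 1 => k * neumannTerm k N

theorem neumannTerm_mul_comm (k : Matrix m m LocallyBoundedMeasurable) (N : ℕ) :
    neumannTerm k N * k = neumannTerm k (N + 1) := by
  induction N with
  | zero => rfl
  | succ N ih => rw [neumannTerm, mul_assoc, ih]; rfl

theorem abs_neumannTerm_le {k : Matrix m m LocallyBoundedMeasurable} {A ω a : ℝ}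
    (hk : ∀ i j t, |(k i j).1 t| ≤ A * Real.exp (ω * t)) (ha : ω < a)
    (hA : Fintype.card m * A / (a - ω) ≤ 1 / 2) (N : ℕ) (i j : m) (t : ℝ≥0) :
    |(neumannTerm k N i j).1 t| ≤ A * (1 / 2) ^ N * Real.exp (a * t) := by
  have hA0 : 0 ≤ A := by simpa using (abs_nonneg _).trans (hk i i 0)
  induction N generalizing i j t with
  | zero =>
    refine (hk i j t).trans ?_
    rw [pow_zero, mul_one]
    exact mul_le_mul_of_nonneg_left (Real.exp_le_exp.2
      (mul_le_mul_of_nonneg_right ha.le t.coe_nonneg)) hA0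
  | succ N ih =>
    rw [neumannTerm, matrix_mul_apply]
    refine (Finset.abs_sum_le_sum_abs _ _).trans ((Finset.sum_le_sum fun l _ =>
      abs_convolve_le_exp ha (hk i l) (ih l j) t).trans ?_)
    rw [Finset.sum_const, Finset.card_univ, nsmul_eq_mul, ← mul_assoc]
    refine mul_le_mul_of_nonneg_right ?_ (Real.exp_nonneg _)
    calc (Fintype.card m : ℝ) * (A * (A * (1 / 2) ^ N) / (a - ω))
        = (Fintype.card m * A / (a - ω)) * (A * (1 / 2) ^ N) := by ring
      _ ≤ 1 / 2 * (A * (1 / 2) ^ N) := mul_le_mul_of_nonneg_right hA (by positivity)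
      _ = A * (1 / 2) ^ (N + 1) := by ring

/-- An exponentially bounded kernel has an exponentially bounded resolvent, the sum of its
Neumann series. -/
theorem exists_resolvent {k : Matrix m m LocallyBoundedMeasurable} {A ω : ℝ} (hA0 : 0 ≤ A)
    (hk : ∀ i j t, |(k i j).1 t| ≤ A * Real.exp (ω * t)) :
    ∃ r : Matrix m m LocallyBoundedMeasurable, r = k + k * r ∧ r = k + r * k ∧
      ∃ B a : ℝ, 0 ≤ B ∧ ω < a ∧ ∀ i j t, |(r i j).1 t| ≤ B * Real.exp (a * t) := by
  -- The rate `a` is so large that convolution with `k` halves the `e^{at}`-weighted bounds.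
  have hcA : 0 ≤ Fintype.card m * A := by positivity
  obtain ⟨a, ha, hA⟩ : ∃ a, ω < a ∧ Fintype.card m * A / (a - ω) ≤ 1 / 2 := by
    refine ⟨ω + (2 * (Fintype.card m * A) + 1), by linarith, ?_⟩
    rw [add_sub_cancel_left, div_le_iff₀ (by linarith)]
    linarith
  have hb := abs_neumannTerm_le hk ha hA
  have hc : Summable fun N : ℕ => A * (1 / 2 : ℝ) ^ N := summable_geometric_two.mul_left A
  have hmem := fun i j => tsum_mem_locallyBoundedMeasurable
    (fun N => (neumannTerm k N i j).2.1) hc (fun N t => hb N i j t)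
  have hs : ∀ i j t, Summable fun N => (neumannTerm k N i j).1 t := fun i j t =>
    Summable.of_norm_bounded (hc.mul_right (Real.exp (a * t))) fun N => hb N i j t
  refine ⟨Matrix.of fun i j => ⟨_, (hmem i j).2⟩, ?_, ?_, _, a, ?_, ha, fun i j => (hmem i j).1⟩
  · ext i j t
    rw [Matrix.add_apply, AddSubgroup.coe_add, Pi.add_apply, matrix_mul_apply]
    refine ((hs i j t).tsum_eq_zero_add).trans (congrArg₂ _ rfl ?_)
    refine HasSum.tsum_eq ?_
    simp only [neumannTerm, matrix_mul_apply]
    exact hasSum_sum fun l _ => hasSum_convolve (k i l).2 (fun N => (neumannTerm k N l j).2.1) hc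
      (fun N t => hb N l j t) t
  · ext i j t
    rw [Matrix.add_apply, AddSubgroup.coe_add, Pi.add_apply, matrix_mul_apply]
    refine ((hs i j t).tsum_eq_zero_add).trans (congrArg₂ _ rfl ?_)
    refine HasSum.tsum_eq ?_
    simp only [← neumannTerm_mul_comm, matrix_mul_apply]
    refine hasSum_sum fun l _ => ?_
    simp only [convolve_comm _ (k l j).1]
    exact hasSum_convolve (k l j).2 (fun N => (neumannTerm k N i l).2.1) hc
      (fun N t => hb N i l t) t
  · exact tsum_nonneg fun N => by positivity

end LocallyBoundedMeasurable

/-! ### Representation of weighted integrals in a norming dual pair -/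

open Polynomial in
/-- The functions `e^{-lt} p(e^{-t})` with `p` a polynomial are dense in the space of functions
that are integrable on `(0, ∞)` with respect to the weight `e^{ωt}`, if `ω < l`: in the variable
`x = e^{-t}` this is the density of the polynomials in `L¹` of a finite measure on `[0, 1]`. -/
theorem exists_polynomial_exp_integral_sub_le {g : ℝ → ℝ} {ω l ε : ℝ} (hl : ω < l)
    (hg : IntegrableOn (fun t => g t * Real.exp (ω * t)) (Set.Ioi 0)) (hε : 0 < ε) :
    ∃ p : ℝ[X], ∫ t in Set.Ioi (0 : ℝ),
      |g t - Real.exp (-l * t) * p.eval (Real.exp (-t))| * Real.exp (ω * t) ≤ ε := by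
  -- `ν = e^{(ω - l)t} dt` is finite, and `m` is its image under `t ↦ e^{-t}`.
  let d : ℝ → ℝ≥0 := fun t => ⟨Real.exp ((ω - l) * t), (Real.exp_pos _).le⟩
  have hd : Measurable d := by
    refine Measurable.subtype_mk ?_
    fun_prop
  set μ : Measure ℝ := volume.restrict (Set.Ioi 0) with hμ
  set ν : Measure ℝ := μ.withDensity fun t => d t with hν
  have hνint : ∀ f : ℝ → ℝ, Integrable f ν ↔ Integrable (fun t => Real.exp ((ω - l) * t) * f t) μ :=
    fun f => integrable_withDensity_iff_integrable_smul hd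
  have hνval : ∀ f : ℝ → ℝ, ∫ t, f t ∂ν = ∫ t, Real.exp ((ω - l) * t) * f t ∂μ :=
    fun f => integral_withDensity_eq_integral_smul hd f
  have hν1 : Integrable (fun _ => (1 : ℝ)) ν := by
    rw [hνint]
    simp only [mul_one]
    exact integrableOn_exp_mul_Ioi (sub_neg.2 hl) 0
  have : IsFiniteMeasure ν := by
    rw [integrable_const_iff] at hν1
    simpa using hν1
  let e : ℝ → ℝ := fun t => Real.exp (-t)
  have he : Measurable e := by fun_prop
  let L : ℝ → ℝ := fun x => -Real.log x
  have hL : Measurable L := Real.measurable_log.neg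
  have hLe : ∀ t, L (e t) = t := fun t => by simp [L, e]
  let G : ℝ → ℝ := fun t => g t * Real.exp (l * t)
  have hG : Integrable G ν := by
    rw [hνint]
    refine hg.congr (Eventually.of_forall fun t => ?_)
    simp only [G]
    rw [mul_left_comm, ← Real.exp_add]
    ring_nf
  have hemb : MeasurableEmbedding e := by
    refine (Continuous.measurableEmbedding (by fun_prop) ?_)
    intro x y h
    rw [← hLe x, ← hLe y, h]
  set m : Measure ℝ := ν.map e with hm
  have : IsFiniteMeasure m := by rw [hm]; infer_instance
  have hF : Integrable (fun x => G (L x)) m := by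
    rw [hm, hemb.integrable_map_iff]
    refine hG.congr (Eventually.of_forall fun t => ?_)
    simp [hLe]
  obtain ⟨h, -, hh, hcont, hhint⟩ :=
    hF.exists_hasCompactSupport_integral_sub_le (half_pos hε)
  set V : ℝ := ∫ _, (1 : ℝ) ∂ν with hV
  have hV0 : 0 ≤ V := integral_nonneg fun _ => zero_le_one
  obtain ⟨p, hp⟩ := exists_polynomial_near_of_continuousOn 0 1 h hcont.continuousOn
    (ε / 2 / (V + 1)) (by positivity)
  refine ⟨p, ?_⟩
  rw [hm, hemb.integral_map] at hh
  have hhint' : Integrable (fun t => h (e t)) ν := by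
    rw [hm, hemb.integrable_map_iff] at hhint
    exact hhint
  have h1 : ∫ t in Set.Ioi (0 : ℝ),
      |g t - Real.exp (-l * t) * p.eval (Real.exp (-t))| * Real.exp (ω * t)
      = ∫ t, |G t - p.eval (e t)| ∂ν := by
    rw [hνval]
    refine integral_congr_ae (Eventually.of_forall fun t => ?_)
    simp only [G]
    have h2 : Real.exp (ω * t) = Real.exp ((ω - l) * t) * Real.exp (l * t) := by
      rw [← Real.exp_add]; ring_nf
    have h3 : g t * Real.exp (l * t) - p.eval (e t) =
        (g t - Real.exp (-l * t) * p.eval (e t)) * Real.exp (l * t) := by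
      rw [sub_mul, mul_right_comm, ← Real.exp_add]
      simp
    rw [h2, h3, abs_mul, abs_of_pos (Real.exp_pos (l * t))]
    ring
  rw [h1]
  have hpos : ∀ᵐ t ∂ν, 0 < t :=
    (withDensity_absolutelyContinuous _ _).ae_le (ae_restrict_mem measurableSet_Ioi)
  have hbd : ∀ᵐ t ∂ν, |G t - p.eval (e t)| ≤ ‖G (L (e t)) - h (e t)‖ + ε / 2 / (V + 1) * 1 := by
    filter_upwards [hpos] with t ht
    rw [hLe, mul_one, Real.norm_eq_abs]
    have hmem : e t ∈ Set.Icc (0 : ℝ) 1 :=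
      ⟨(Real.exp_pos _).le, Real.exp_le_one_iff.2 (by linarith)⟩
    have := (abs_sub_comm (h (e t)) (p.eval (e t))).le.trans (hp _ hmem).le
    exact (abs_sub_le _ (h (e t)) _).trans (by linarith)
  have hint1 : Integrable (fun t => ‖G (L (e t)) - h (e t)‖) ν := by
    simp only [hLe]
    exact (hG.sub hhint').norm
  refine (integral_mono_of_nonneg (Eventually.of_forall fun t => abs_nonneg _)
    (hint1.add (hν1.const_mul _)) hbd).trans ?_
  rw [integral_add' hint1 (hν1.const_mul _), integral_const_mul]
  have h4 : ε / 2 / (V + 1) * V ≤ ε / 2 := by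
    rw [div_mul_eq_mul_div, div_le_iff₀ (by positivity)]
    nlinarith
  linarith

namespace NormingDualPair

variable {Y Yd : Type*} [NormedAddCommGroup Y] [NormedSpace ℝ Y]
  [NormedAddCommGroup Yd] [NormedSpace ℝ Yd]

/-- The norming dual pair with the roles of the two spaces exchanged. -/
def flip (P : NormingDualPair Y Yd) : NormingDualPair Yd Y where
  pairing := P.pairing.flip
  bounded := by
    obtain ⟨M, hM, h⟩ := P.bounded
    exact ⟨M, hM, fun y yd => (h yd y).trans (le_of_eq (by ring))⟩
  norm_isLUB := P.dual_norm_isLUB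
  dual_norm_isLUB := P.norm_isLUB

theorem norm_le_of_pairing_le (P : NormingDualPair Y Yd) {y : Y} {c : ℝ} (hc : 0 ≤ c)
    (h : ∀ yd, |P.pairing yd y| ≤ c * ‖yd‖) : ‖y‖ ≤ c := by
  refine (P.norm_isLUB y).2 ?_
  rintro a ⟨yd, hyd, rfl⟩
  exact (h yd).trans (mul_le_of_le_one_right hc hyd)

theorem pairing_ext (P : NormingDualPair Y Yd) {y z : Y}
    (h : ∀ yd, P.pairing yd y = P.pairing yd z) : y = z := by
  have : ‖y - z‖ ≤ 0 := P.norm_le_of_pairing_le le_rfl fun yd => by simp [h yd]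
  exact sub_eq_zero.1 (norm_le_zero_iff.1 this)

/-- Since `Y` is complete and its norm is the dual norm, functionals on `Y^⋄` that are norm limits
of functionals represented by elements of `Y` are represented by elements of `Y`. -/
theorem exists_pairing_eq_of_approx [CompleteSpace Y] (P : NormingDualPair Y Yd) {φ : Yd → ℝ}
    (h : ∀ ε > 0, ∃ z : Y, ∀ yd, |φ yd - P.pairing yd z| ≤ ε * ‖yd‖) :
    ∃ z : Y, ∀ yd, φ yd = P.pairing yd z := by
  choose z hz using fun N : ℕ => h (1 / ((N : ℝ) + 1)) Nat.one_div_pos_of_nat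
  have hlim := tendsto_one_div_add_atTop_nhds_zero_nat (𝕜 := ℝ)
  have hcau : CauchySeq z := by
    refine cauchySeq_of_le_tendsto_0 (fun N : ℕ => 2 * (1 / ((N : ℝ) + 1))) ?_ ?_
    · intro i j N hi hj
      rw [dist_eq_norm]
      refine P.norm_le_of_pairing_le (by positivity) fun yd => ?_
      have hb : ∀ i ≥ N, |φ yd - P.pairing yd (z i)| ≤ 1 / ((N : ℝ) + 1) * ‖yd‖ := fun i hi =>
        (hz i yd).trans (mul_le_mul_of_nonneg_right (Nat.one_div_le_one_div hi) (norm_nonneg _))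
      have h1 := hb i hi
      have h2 := hb j hj
      rw [map_sub]
      have h3 := abs_sub_le (P.pairing yd (z i)) (φ yd) (P.pairing yd (z j))
      rw [abs_sub_comm _ (φ yd)] at h3
      linarith
    · simpa using hlim.const_mul 2
  obtain ⟨y, hy⟩ := cauchySeq_tendsto_of_complete hcau
  refine ⟨y, fun yd => ?_⟩
  have hpair : Tendsto (fun N => P.pairing yd (z N)) atTop (𝓝 (P.pairing yd y)) := by
    obtain ⟨M, -, hM⟩ := P.bounded
    rw [tendsto_iff_norm_sub_tendsto_zero] at hy ⊢
    refine squeeze_zero (fun _ => norm_nonneg _) (fun N => ?_)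
      (by simpa using hy.const_mul (M * ‖yd‖))
    rw [← map_sub]
    exact hM _ _
  have hphi : Tendsto (fun N => P.pairing yd (z N)) atTop (𝓝 (φ yd)) := by
    rw [tendsto_iff_norm_sub_tendsto_zero]
    refine squeeze_zero (fun _ => norm_nonneg _) (fun N => ?_)
      (by simpa using hlim.mul_const ‖yd‖)
    rw [norm_sub_rev]
    simpa using hz N yd
  exact tendsto_nhds_unique hphi hpair

/-- If the Laplace transforms of a family of functionals `s t` on `Y^⋄` are represented by elements
of `Y`, then so are the integrals of `s t` against all suitably integrable weights, as these
are approximated by linear combinations of exponentials. -/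
theorem exists_pairing_eq_integral [CompleteSpace Y] (P : NormingDualPair Y Yd)
    {s : ℝ → Yd → ℝ} {C ω : ℝ} (hs : ∀ yd, Measurable fun t => s t yd)
    (hbound : ∀ t > 0, ∀ yd, |s t yd| ≤ C * Real.exp (ω * t) * ‖yd‖)
    (hlap : ∀ l > ω, ∃ z, ∀ yd, P.pairing yd z = ∫ t in Set.Ioi (0 : ℝ), Real.exp (-l * t) * s t yd)
    {g : ℝ → ℝ} (hg : IntegrableOn (fun t => g t * Real.exp (ω * t)) (Set.Ioi 0)) :
    ∃ z : Y, ∀ yd, ∫ t in Set.Ioi (0 : ℝ), g t * s t yd = P.pairing yd z := by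
  -- integrability of `g t * s t yd` for weights `g`
  have hint : ∀ {g : ℝ → ℝ}, IntegrableOn (fun t => g t * Real.exp (ω * t)) (Set.Ioi 0) →
      ∀ yd, IntegrableOn (fun t => g t * s t yd) (Set.Ioi 0) := by
    intro g hg yd
    have h1 : IntegrableOn (fun t => (s t yd * Real.exp (-(ω * t))) *
        (g t * Real.exp (ω * t))) (Set.Ioi 0) := by
      refine Integrable.bdd_mul (c := C * ‖yd‖) hg ((hs yd).mul (by fun_prop)).aestronglyMeasurable
        ((ae_restrict_iff' measurableSet_Ioi).2 (Eventually.of_forall fun t ht => ?_))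
      rw [norm_mul, Real.norm_eq_abs, Real.norm_eq_abs, abs_of_pos (Real.exp_pos _)]
      calc |s t yd| * Real.exp (-(ω * t))
          ≤ C * Real.exp (ω * t) * ‖yd‖ * Real.exp (-(ω * t)) :=
            mul_le_mul_of_nonneg_right (hbound t ht yd) (Real.exp_pos _).le
        _ = C * ‖yd‖ * (Real.exp (ω * t) * Real.exp (-(ω * t))) := by ring
        _ = C * ‖yd‖ := by rw [← Real.exp_add]; simp
    refine h1.congr (Eventually.of_forall fun t => ?_)
    calc s t yd * Real.exp (-(ω * t)) * (g t * Real.exp (ω * t))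
        = g t * s t yd * (Real.exp (ω * t) * Real.exp (-(ω * t))) := by ring
      _ = g t * s t yd := by rw [← Real.exp_add]; simp
  have hexp : ∀ l > ω, IntegrableOn (fun t => Real.exp (-l * t) * Real.exp (ω * t))
      (Set.Ioi 0) := by
    intro l hl
    refine (integrableOn_exp_mul_Ioi (sub_neg.2 hl) 0).congr (Eventually.of_forall fun t => ?_)
    dsimp only
    rw [← Real.exp_add]
    ring_nf
  obtain ⟨l, hl⟩ := exists_gt ω
  -- polynomials in `e^{-t}`
  have hpoly : ∀ p : Polynomial ℝ,
      IntegrableOn (fun t => Real.exp (-l * t) * p.eval (Real.exp (-t)) * Real.exp (ω * t))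
        (Set.Ioi 0) ∧ ∃ z, ∀ yd, ∫ t in Set.Ioi (0 : ℝ),
          Real.exp (-l * t) * p.eval (Real.exp (-t)) * s t yd = P.pairing yd z := by
    intro p
    induction p using Polynomial.induction_on' with
    | add p₁ p₂ h₁ h₂ =>
      obtain ⟨hi₁, z₁, hz₁⟩ := h₁
      obtain ⟨hi₂, z₂, hz₂⟩ := h₂
      simp only [Polynomial.eval_add, mul_add, add_mul]
      refine ⟨hi₁.add hi₂, z₁ + z₂, fun yd => ?_⟩
      rw [map_add, ← hz₁, ← hz₂]
      exact integral_add (hint hi₁ yd) (hint hi₂ yd)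
    | monomial N c =>
      have hmon : ∀ t, Real.exp (-l * t) * (Polynomial.monomial N c).eval (Real.exp (-t)) =
          c * Real.exp (-(l + N) * t) := by
        intro t
        rw [Polynomial.eval_monomial, ← Real.exp_nat_mul, mul_left_comm, ← Real.exp_add]
        ring_nf
      have hlN : ω < l + N := hl.trans_le (by simp)
      obtain ⟨z, hz⟩ := hlap _ hlN
      simp only [hmon, mul_assoc c]
      refine ⟨(hexp _ hlN).const_mul c, c • z, fun yd => ?_⟩
      rw [integral_const_mul, map_smul, hz, smul_eq_mul]
  refine P.exists_pairing_eq_of_approx fun ε hε => ?_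
  have hC : 0 < |C| + 1 := by positivity
  obtain ⟨p, hp⟩ := exists_polynomial_exp_integral_sub_le hl hg (div_pos hε hC)
  obtain ⟨hi, z, hz⟩ := hpoly p
  refine ⟨z, fun yd => ?_⟩
  rw [← hz, ← integral_sub (hint hg yd) (hint hi yd), ← Real.norm_eq_abs]
  have hdiff : IntegrableOn (fun t => |g t - Real.exp (-l * t) * p.eval (Real.exp (-t))| *
      Real.exp (ω * t)) (Set.Ioi 0) := by
    refine (hg.sub hi).norm.congr (Eventually.of_forall fun t => ?_)
    simp only [Pi.sub_apply]
    rw [← sub_mul, norm_mul, Real.norm_eq_abs, Real.norm_eq_abs, abs_of_pos (Real.exp_pos _)]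
  refine (norm_integral_le_of_norm_le (hdiff.const_mul (C * ‖yd‖))
    ((ae_restrict_iff' measurableSet_Ioi).2 (Eventually.of_forall fun t ht => ?_))).trans ?_
  · rw [← sub_mul, norm_mul, Real.norm_eq_abs, Real.norm_eq_abs]
    refine (mul_le_mul_of_nonneg_left (hbound t ht yd) (abs_nonneg _)).trans (le_of_eq ?_)
    ring
  · rw [integral_const_mul]
    set I := ∫ t in Set.Ioi (0 : ℝ), |g t - Real.exp (-l * t) * p.eval (Real.exp (-t))| *
      Real.exp (ω * t)
    have hI : 0 ≤ I := integral_nonneg fun t => by positivity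
    calc C * ‖yd‖ * I ≤ (|C| + 1) * ‖yd‖ * (ε / (|C| + 1)) := by
          refine mul_le_mul (mul_le_mul_of_nonneg_right ?_ (norm_nonneg _)) hp hI (by positivity)
          linarith [le_abs_self C]
      _ = ε * ‖yd‖ := by field_simp

end NormingDualPair

/-! ### Laplace transforms -/

/-- Measurable functions `f` on `[0, ∞)` with `|f t| ≤ C e^{ωt}` for some `C`. -/
def ExpBounded (ω : ℝ) (f : ℝ≥0 → ℝ) : Prop :=
  Measurable f ∧ ∃ C : ℝ, ∀ t : ℝ≥0, |f t| ≤ C * Real.exp (ω * t)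

namespace ExpBounded

variable {ω a : ℝ} {f g : ℝ≥0 → ℝ}

theorem mono (hf : ExpBounded ω f) (ha : ω ≤ a) : ExpBounded a f := by
  obtain ⟨hm, C, hC⟩ := hf
  have hC0 : 0 ≤ C := by simpa using (abs_nonneg _).trans (hC 0)
  exact ⟨hm, C, fun t => (hC t).trans (mul_le_mul_of_nonneg_left
    (Real.exp_le_exp.2 (mul_le_mul_of_nonneg_right ha t.coe_nonneg)) hC0)⟩

theorem mem (hf : ExpBounded ω f) : f ∈ LocallyBoundedMeasurable := by
  obtain ⟨hm, C, hC⟩ := hf.mono (le_abs_self ω)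
  have hC0 : 0 ≤ C := by simpa using (abs_nonneg _).trans (hC 0)
  refine ⟨hm, fun T => ⟨C * Real.exp (|ω| * T), fun t ht => (hC t).trans ?_⟩⟩
  exact mul_le_mul_of_nonneg_left (Real.exp_le_exp.2
    (mul_le_mul_of_nonneg_left (by exact_mod_cast ht) (abs_nonneg _))) hC0

theorem convolve (hf : ExpBounded ω f) (hg : ExpBounded a g) (ha : ω < a) :
    ExpBounded a (convolve f g) := by
  obtain ⟨A, hA⟩ := hf.2
  obtain ⟨B, hB⟩ := hg.2
  exact ⟨(convolve_mem hf.mem hg.mem).1, _, abs_convolve_le_exp ha hA hB⟩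

theorem integrableOn (hf : ExpBounded ω f) {z : ℂ} (hz : ω < z.re) :
    IntegrableOn (fun t : ℝ => Complex.exp (-z * t) * (f t.toNNReal : ℂ)) (Set.Ioi 0) := by
  obtain ⟨hm, C, hC⟩ := hf
  refine ((integrableOn_exp_mul_Ioi (sub_neg.2 hz) 0).const_mul C).mono' ?_
    ((ae_restrict_iff' measurableSet_Ioi).2 (Eventually.of_forall fun t ht => ?_))
  · exact (Measurable.mul (by fun_prop)
      (Complex.measurable_ofReal.comp (hm.comp measurable_real_toNNReal))).aestronglyMeasurable
  · rw [norm_mul, Complex.norm_exp, Complex.norm_real, Real.norm_eq_abs]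
    have h1 : (-z * (t : ℂ)).re = -z.re * t := by simp
    have h2 := hC t.toNNReal
    rw [Real.coe_toNNReal _ (le_of_lt ht)] at h2
    rw [h1]
    refine (mul_le_mul_of_nonneg_left h2 (Real.exp_pos _).le).trans (le_of_eq ?_)
    rw [mul_left_comm, ← Real.exp_add]
    ring_nf

theorem integrableOn_real (hf : ExpBounded ω f) {l : ℝ} (hl : ω < l) :
    IntegrableOn (fun t : ℝ => Real.exp (-l * t) * f t.toNNReal) (Set.Ioi 0) := by
  refine (hf.integrableOn (z := l) (by simpa using hl)).re.congr (Eventually.of_forall fun t => ?_)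
  have : Complex.exp (-(l : ℂ) * t) * (f t.toNNReal : ℂ)
      = ((Real.exp (-l * t) * f t.toNNReal : ℝ) : ℂ) := by push_cast; rfl
  dsimp only
  rw [this]
  exact Complex.ofReal_re _

end ExpBounded

/-- The Laplace transform of a real function on `[0, ∞)`. -/
def laplace (f : ℝ≥0 → ℝ) (z : ℂ) : ℂ :=
  ∫ t in Set.Ioi (0 : ℝ), Complex.exp (-z * t) * (f t.toNNReal : ℂ)

theorem laplace_ofReal (f : ℝ≥0 → ℝ) (l : ℝ) :
    laplace f l = ((∫ t in Set.Ioi (0 : ℝ), Real.exp (-l * t) * f t.toNNReal : ℝ) : ℂ) := by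
  rw [laplace, ← integral_complex_ofReal]
  congr 1
  ext t
  push_cast
  rfl

theorem laplace_add {f g : ℝ≥0 → ℝ} {ω : ℝ} (hf : ExpBounded ω f) (hg : ExpBounded ω g) {z : ℂ}
    (hz : ω < z.re) : laplace (fun t => f t + g t) z = laplace f z + laplace g z := by
  rw [laplace, laplace, laplace, ← integral_add (hf.integrableOn hz) (hg.integrableOn hz)]
  congr 1
  ext t
  push_cast
  ring

theorem laplace_sum {ι : Type*} (s : Finset ι) {f : ι → ℝ≥0 → ℝ} {ω : ℝ}
    (hf : ∀ i, ExpBounded ω (f i)) {z : ℂ} (hz : ω < z.re) :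
    laplace (fun t => ∑ i ∈ s, f i t) z = ∑ i ∈ s, laplace (f i) z := by
  simp only [laplace]
  rw [← integral_finsetSum _ fun i _ => (hf i).integrableOn hz]
  congr 1
  ext t
  push_cast
  rw [Finset.mul_sum]

theorem laplace_convolve {f g : ℝ≥0 → ℝ} {ω : ℝ} (hf : ExpBounded ω f) (hg : ExpBounded ω g)
    {z : ℂ} (hz : ω < z.re) : laplace (convolve f g) z = laplace f z * laplace g z := by
  have h := integral_posConvolution (hg.integrableOn hz) (hf.integrableOn hz)
    (ContinuousLinearMap.mul ℝ ℂ)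
  rw [mul_comm, laplace, laplace, laplace]
  refine Eq.trans ?_ h
  refine setIntegral_congr_fun measurableSet_Ioi fun t ht => ?_
  have ht' : (0 : ℝ) ≤ t := le_of_lt ht
  rw [convolve, Real.coe_toNNReal _ ht', ← intervalIntegral.integral_ofReal,
    ← intervalIntegral.integral_const_mul]
  congr 1
  ext τ
  rw [ContinuousLinearMap.mul_apply', mul_mul_mul_comm, ← Complex.exp_add, Complex.ofReal_mul,
    mul_comm (f _ : ℂ)]
  congr 2
  push_cast
  ring

/-- The scalar resolvent identity, by Fubini's theorem: in the integral of `e^{-μt - ls} f(t + s)`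
over the quadrant, `f(u)` has the weight `∫₀ᵘ e^{-μt - l(u - t)} dt = (e^{-lu} - e^{-μu}) / (μ - l)`. -/
theorem laplace_resolvent_identity {f : ℝ≥0 → ℝ} {ω l μ : ℝ} (hf : ExpBounded ω f) (hl : ω < l)
    (hμ : ω < μ) :
    (μ - l) * ∫ t in Set.Ioi (0 : ℝ), Real.exp (-μ * t) *
      ∫ s in Set.Ioi (0 : ℝ), Real.exp (-l * s) * f (t + s).toNNReal =
    (∫ t in Set.Ioi (0 : ℝ), Real.exp (-l * t) * f t.toNNReal) -
      ∫ t in Set.Ioi (0 : ℝ), Real.exp (-μ * t) * f t.toNNReal := by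
  obtain ⟨C, hC⟩ := hf.2
  let A : ℝ → ℝ := (Set.Ioi 0).indicator fun t => Real.exp ((ω - μ) * t)
  let B : ℝ → ℝ := (Set.Ioi 0).indicator fun t => Real.exp ((ω - l) * t)
  let φ : ℝ → ℝ := (Set.Ioi 0).indicator fun u => Real.exp (-ω * u) * f u.toNNReal
  have hA : Integrable A :=
    (integrable_indicator_iff measurableSet_Ioi).2 (integrableOn_exp_mul_Ioi (sub_neg.2 hμ) 0)
  have hB : Integrable B :=
    (integrable_indicator_iff measurableSet_Ioi).2 (integrableOn_exp_mul_Ioi (sub_neg.2 hl) 0)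
  have hφm : Measurable φ := by
    refine Measurable.indicator (Measurable.mul (by fun_prop) ?_) measurableSet_Ioi
    exact hf.1.comp measurable_real_toNNReal
  have hC0 : 0 ≤ C := by simpa using (abs_nonneg _).trans (hC 0)
  have hφb : ∀ u, ‖φ u‖ ≤ C := by
    intro u
    by_cases hu : u ∈ Set.Ioi (0 : ℝ)
    · simp only [φ, Set.indicator_of_mem hu]
      rw [norm_mul, Real.norm_eq_abs, Real.norm_eq_abs, abs_of_pos (Real.exp_pos _)]
      have := hC u.toNNReal
      rw [Real.coe_toNNReal _ (le_of_lt hu)] at this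
      refine (mul_le_mul_of_nonneg_left this (Real.exp_pos _).le).trans (le_of_eq ?_)
      rw [mul_left_comm, ← Real.exp_add]
      simp
    · simpa only [φ, Set.indicator_of_notMem hu, norm_zero] using hC0
  have hint : Integrable (Function.uncurry fun u t => φ u * (A t * B (u - t)))
      (volume.prod volume) := by
    refine Integrable.bdd_mul (c := C) (hA.convolution_integrand (ContinuousLinearMap.mul ℝ ℝ) hB)
      (hφm.comp measurable_fst).aestronglyMeasurable (Eventually.of_forall fun p => hφb p.1)
  have h1 : ∫ t in Set.Ioi (0 : ℝ), Real.exp (-μ * t) *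
      ∫ s in Set.Ioi (0 : ℝ), Real.exp (-l * s) * f (t + s).toNNReal =
      ∫ t, ∫ u, φ u * (A t * B (u - t)) := by
    rw [← integral_indicator measurableSet_Ioi]
    congr 1
    ext t
    -- the substitution `u = s + t`
    rw [← integral_add_right_eq_self _ t]
    by_cases ht : t ∈ Set.Ioi (0 : ℝ)
    · rw [Set.indicator_of_mem ht, ← integral_const_mul, ← integral_indicator measurableSet_Ioi]
      congr 1
      ext s
      simp only [add_sub_cancel_right, A, B, Set.indicator_of_mem ht]
      by_cases hs : s ∈ Set.Ioi (0 : ℝ)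
      · have hst : s + t ∈ Set.Ioi (0 : ℝ) := Set.mem_Ioi.2 (add_pos hs ht)
        simp only [φ, Set.indicator_of_mem hs, Set.indicator_of_mem hst]
        rw [← Real.exp_add, mul_right_comm, ← Real.exp_add, ← mul_assoc, ← Real.exp_add,
          add_comm t s]
        congr 2
        ring
      · simp only [Set.indicator_of_notMem hs, mul_zero]
    · rw [Set.indicator_of_notMem ht]
      simp only [A, Set.indicator_of_notMem ht, zero_mul, mul_zero, integral_zero]
  have h2 : ∀ u, (μ - l) * ∫ t, A t * B (u - t) =
      (Set.Ioi 0).indicator (fun u => Real.exp ((ω - l) * u) - Real.exp ((ω - μ) * u)) u := by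
    intro u
    have h3 := congrFun (posConvolution_eq_convolution_indicator
      (fun t => Real.exp ((ω - μ) * t)) (fun t => Real.exp ((ω - l) * t))
      (ContinuousLinearMap.mul ℝ ℝ) volume) u
    change _ = ∫ t, A t * B (u - t) at h3
    rw [← h3, posConvolution]
    by_cases hu : u ∈ Set.Ioi (0 : ℝ)
    · rw [Set.indicator_of_mem hu, Set.indicator_of_mem hu]
      simp only [ContinuousLinearMap.mul_apply']
      have h4 : ∀ t, Real.exp ((ω - μ) * t) * Real.exp ((ω - l) * (u - t)) =
          Real.exp ((ω - l) * u) * Real.exp ((l - μ) * t) := fun t => by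
        rw [← Real.exp_add, ← Real.exp_add]
        ring_nf
      simp only [h4]
      rw [intervalIntegral.integral_const_mul]
      rcases eq_or_ne μ l with rfl | hne
      · simp
      · have hne' : l - μ ≠ 0 := sub_ne_zero.2 hne.symm
        rw [intervalIntegral.integral_comp_mul_left (fun x => Real.exp x) hne', integral_exp,
          mul_zero, Real.exp_zero, smul_eq_mul]
        have h5 : Real.exp ((ω - μ) * u) = Real.exp ((ω - l) * u) * Real.exp ((l - μ) * u) := by
          rw [← Real.exp_add]
          ring_nf
        rw [h5]
        field_simp
        ring
    · rw [Set.indicator_of_notMem hu, Set.indicator_of_notMem hu, mul_zero]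
  rw [h1, ← integral_integral_swap hint, ← integral_sub (hf.integrableOn_real hl)
    (hf.integrableOn_real hμ), ← integral_const_mul, ← integral_indicator measurableSet_Ioi]
  congr 1
  ext u
  rw [integral_const_mul, mul_left_comm, h2]
  by_cases hu : u ∈ Set.Ioi (0 : ℝ)
  · simp only [φ, Set.indicator_of_mem hu]
    rw [mul_right_comm, mul_sub, ← Real.exp_add, ← Real.exp_add, sub_mul]
    ring_nf
  · simp only [φ, Set.indicator_of_notMem hu, zero_mul]

/-! ### The generator of a twin semigroup -/

section TwinSemigroups

variable {Y Yd : Type*} [NormedAddCommGroup Y] [NormedSpace ℝ Y]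
  [NormedAddCommGroup Yd] [NormedSpace ℝ Yd] {P : NormingDualPair Y Yd}

/-- A bounded function `B` of two variables that is represented by elements of `Y` and of `Y^⋄`
is the form of a twin operator; bilinearity and weak continuity are consequences. -/
def TwinOperator.ofRepresentable (B : Yd → Y → ℝ) (h₁ : ∀ y, ∃ z, ∀ yd, B yd y = P.pairing yd z)
    (h₂ : ∀ yd, ∃ zd, ∀ y, B yd y = P.pairing zd y)
    (hb : ∃ K : ℝ, 0 < K ∧ ∀ yd y, |B yd y| ≤ K * ‖yd‖ * ‖y‖) : TwinOperator P where
  form := LinearMap.mk₂ ℝ B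
    (fun yd yd' y => by obtain ⟨z, hz⟩ := h₁ y; simp [hz])
    (fun c yd y => by obtain ⟨z, hz⟩ := h₁ y; simp [hz])
    (fun yd y y' => by obtain ⟨z, hz⟩ := h₂ yd; simp [hz])
    (fun c yd y => by obtain ⟨z, hz⟩ := h₂ yd; simp [hz])
  bounded := hb
  continuous_diamond y := by
    obtain ⟨z, hz⟩ := h₁ y
    exact (WeakBilin.eval_continuous P.pairing z).congr fun yd => (hz yd).symm
  continuous_state yd := by
    obtain ⟨z, hz⟩ := h₂ yd
    exact (WeakBilin.eval_continuous P.pairing.flip z).congr fun y => (hz y).symm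

theorem IsLaplaceTransform.form_eq {S : ℝ≥0 → TwinOperator P} {l : ℝ} {R : TwinOperator P}
    (hR : IsLaplaceTransform S l R) (yd : Yd) (y : Y) :
    (R.form yd y : ℂ) = laplace (fun t => (S t).form yd y) l := by
  rw [laplace_ofReal, hR]

theorem IsComplexLaplaceTransform.isLaplaceTransform {S : ℝ≥0 → TwinOperator P} {l : ℝ}
    {R J : TwinOperator P} (h : IsComplexLaplaceTransform S l R J) : IsLaplaceTransform S l R := by
  intro yd y
  have h1 := h yd y
  change _ = laplace (fun t => (S t).form yd y) l at h1
  rw [laplace_ofReal] at h1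
  simpa using congrArg Complex.re h1

namespace IsTwinSemigroup

variable {S : ℝ≥0 → TwinOperator P} {M ω : ℝ}

theorem expBounded (hS : IsTwinSemigroup S) (hM : HasGrowthBound S M ω) (yd : Yd) (y : Y) :
    ExpBounded ω fun t => (S t).form yd y :=
  ⟨hS.measurable yd y, M * ‖y‖ * ‖yd‖, fun t => (hM.2 t yd y).trans (le_of_eq (by ring))⟩

theorem form_coact (hS : IsTwinSemigroup S) (t s : ℝ≥0) (yd : Yd) (y : Y) :
    (S s).form ((S t).coact yd) y = (S (t + s)).form yd y := by
  rw [hS.map_add, TwinOperator.pairing_act]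

/-- The resolvent identity `(μ - l) Q R = R - Q`. -/
theorem resolvent_identity (hS : IsTwinSemigroup S) (hM : HasGrowthBound S M ω) {l μ : ℝ}
    (hl : ω < l) (hμ : ω < μ) {R Q : TwinOperator P} (hR : IsLaplaceTransform S l R)
    (hQ : IsLaplaceTransform S μ Q) (yd : Yd) (x : Y) :
    (μ - l) * Q.form yd (R.act x) = R.form yd x - Q.form yd x := by
  rw [hQ yd x, hR yd x, ← laplace_resolvent_identity (hS.expBounded hM yd x) hl hμ, hQ]
  congr 1
  refine setIntegral_congr_fun measurableSet_Ioi fun t ht => ?_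
  rw [← TwinOperator.pairing_coact, TwinOperator.pairing_act, hR]
  congr 1
  refine setIntegral_congr_fun measurableSet_Ioi fun s hs => ?_
  rw [hS.form_coact, Real.toNNReal_add (le_of_lt ht) (le_of_lt hs)]

/-- The graph of the generator can be computed from the Laplace transform at any admissible
point. -/
theorem eq_act_of_mem_generatorGraph (hS : IsTwinSemigroup S) {p : Y × Y}
    (hp : p ∈ generatorGraph S) (hM : HasGrowthBound S M ω) {μ : ℝ} (hμ : ω < μ)
    {Q : TwinOperator P} (hQ : IsLaplaceTransform S μ Q) : p.1 = Q.act (μ • p.1 - p.2) := by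
  obtain ⟨M', ω', l, R, hM', hl, hR, hp⟩ := hp
  have key : ∀ yd x, (μ - l) * Q.form yd (R.act x) = R.form yd x - Q.form yd x := by
    intro yd x
    -- The identity needs one growth bound below both points: that of the smaller one.
    rcases le_total l μ with h | h
    · exact hS.resolvent_identity hM' hl (hl.trans_le h) hR hQ yd x
    · exact hS.resolvent_identity hM (hμ.trans_le h) hμ hR hQ yd x
  refine P.pairing_ext fun yd => ?_
  have h1 := key yd (l • p.1 - p.2)
  have h2 : μ • p.1 - p.2 = (l • p.1 - p.2) + (μ - l) • p.1 := by
    rw [sub_smul]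
    abel
  rw [TwinOperator.pairing_act, h2, LinearMap.map_add, LinearMap.map_smul, smul_eq_mul]
  rw [← hp] at h1
  rw [h1, ← R.pairing_act, ← hp]
  ring

end IsTwinSemigroup

end TwinSemigroups

/-! ### Shifted convolutions and representable functionals -/

/-- Splitting the integral that defines `(f * g)(t + s)` at `s`. -/
theorem convolve_add_apply {f g : ℝ≥0 → ℝ} (hf : f ∈ LocallyBoundedMeasurable)
    (hg : g ∈ LocallyBoundedMeasurable) (t s : ℝ≥0) :
    convolve f g (t + s) =
      convolve (fun τ => f (t + τ)) g s + convolve f (fun τ => g (s + τ)) t := by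
  set F : ℝ → ℝ := fun τ => f (((t + s : ℝ≥0) : ℝ) - τ).toNNReal * g τ.toNNReal with hF
  have hint : ∀ a ≥ 0, ∀ b ≤ ((t + s : ℝ≥0) : ℝ), a ≤ b → IntervalIntegrable F volume a b := by
    intro a ha b hb hab
    have h1 := integrable_extendByZero_mul hg hf ((t + s : ℝ≥0) : ℝ)
    refine (h1.intervalIntegrable (a := a) (b := b)).congr fun τ hτ => ?_
    rw [Set.uIoc_of_le hab] at hτ
    have h2 : 0 ≤ ((t + s : ℝ≥0) : ℝ) - τ := by linarith [hτ.2]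
    simp only [hF]
    rw [extendByZero_of_nonneg _ (ha.trans hτ.1.le), extendByZero_of_nonneg _ h2, mul_comm]
  have hs : (s : ℝ) ≤ ((t + s : ℝ≥0) : ℝ) := by simp
  rw [convolve, ← intervalIntegral.integral_add_adjacent_intervals
    (hint 0 le_rfl s hs s.2) (hint s s.2 _ le_rfl hs)]
  congr 1
  · refine intervalIntegral.integral_congr fun τ hτ => ?_
    rw [Set.uIcc_of_le s.coe_nonneg] at hτ
    simp only [hF]
    congr 2
    rw [NNReal.coe_add, add_sub_assoc, Real.toNNReal_add t.coe_nonneg (sub_nonneg.2 hτ.2),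
      Real.toNNReal_coe]
  · have h3 := intervalIntegral.integral_comp_add_right (a := 0) (b := (t : ℝ)) F (s : ℝ)
    rw [zero_add, ← NNReal.coe_add] at h3
    rw [← h3]
    refine intervalIntegral.integral_congr fun τ hτ => ?_
    rw [Set.uIcc_of_le t.coe_nonneg] at hτ
    simp only [hF]
    congr 2
    · congr 1
      push_cast
      ring
    · rw [add_comm τ, Real.toNNReal_add s.coe_nonneg hτ.1, Real.toNNReal_coe]

theorem convolve_apply_zero (f g : ℝ≥0 → ℝ) : convolve f g 0 = 0 := by
  simp [convolve]

theorem LocallyBoundedMeasurable.shift_mem {g : ℝ≥0 → ℝ} (hg : g ∈ LocallyBoundedMeasurable)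
    (s : ℝ≥0) : (fun τ => g (s + τ)) ∈ LocallyBoundedMeasurable :=
  ⟨hg.1.comp (measurable_const.add measurable_id), fun T =>
    (hg.2 (s + T)).imp fun _ hK t ht => hK _ (by gcongr)⟩

section DualPair

variable {Y Yd : Type*} [NormedAddCommGroup Y] [NormedSpace ℝ Y]
  [NormedAddCommGroup Yd] [NormedSpace ℝ Yd]

/-- The weighted integral with the weight `τ ↦ h (t - τ)` on `(0, t]`. -/
theorem NormingDualPair.exists_pairing_eq_convolve [CompleteSpace Y] (P : NormingDualPair Y Yd)
    {s : ℝ≥0 → Yd → ℝ} {C ω : ℝ} (hs : ∀ yd, Measurable fun t => s t yd)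
    (hbound : ∀ t yd, |s t yd| ≤ C * Real.exp (ω * t) * ‖yd‖)
    (hlap : ∀ l > ω, ∃ z, ∀ yd, P.pairing yd z =
      ∫ t in Set.Ioi (0 : ℝ), Real.exp (-l * t) * s t.toNNReal yd)
    {h : ℝ≥0 → ℝ} (hh : h ∈ LocallyBoundedMeasurable) (t : ℝ≥0) :
    ∃ z : Y, ∀ yd, convolve h (fun τ => s τ yd) t = P.pairing yd z := by
  let g : ℝ → ℝ := (Set.Ioc 0 (t : ℝ)).indicator fun τ => h ((t : ℝ) - τ).toNNReal
  obtain ⟨K, hK0, hK⟩ := LocallyBoundedMeasurable.exists_bound hh t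
  have hgm : Measurable g := (hh.1.comp (measurable_real_toNNReal.comp
    (measurable_const.sub measurable_id))).indicator measurableSet_Ioc
  have hg : IntegrableOn (fun τ => g τ * Real.exp (ω * τ)) (Set.Ioi 0) := by
    refine Integrable.integrableOn ?_
    have hi : Integrable ((Set.Ioc 0 (t : ℝ)).indicator fun τ => K * Real.exp (ω * τ)) := by
      rw [integrable_indicator_iff measurableSet_Ioc]
      exact (Continuous.integrableOn_Icc (by fun_prop)).mono_set Set.Ioc_subset_Icc_self
    refine hi.mono' (hgm.mul (by fun_prop)).aestronglyMeasurable
      (Eventually.of_forall fun τ => ?_)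
    by_cases hτ : τ ∈ Set.Ioc 0 (t : ℝ)
    · simp only [g, Set.indicator_of_mem hτ]
      rw [norm_mul, Real.norm_eq_abs, Real.norm_eq_abs, abs_of_pos (Real.exp_pos _)]
      exact mul_le_mul_of_nonneg_right (hK _ (Real.toNNReal_le_iff_le_coe.2 (by linarith [hτ.1])))
        (Real.exp_pos _).le
    · simp [g, Set.indicator_of_notMem hτ]
  obtain ⟨z, hz⟩ := P.exists_pairing_eq_integral (s := fun t yd => s t.toNNReal yd)
    (fun yd => (hs yd).comp measurable_real_toNNReal)
    (fun t ht yd => by simpa [ht.le] using hbound t.toNNReal yd) hlap hg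
  refine ⟨z, fun yd => ?_⟩
  rw [← hz, convolve, intervalIntegral.integral_of_le t.coe_nonneg,
    ← integral_indicator measurableSet_Ioc, ← integral_indicator measurableSet_Ioi]
  congr 1
  ext τ
  by_cases hτ : τ ∈ Set.Ioc 0 (t : ℝ)
  · have hτ' : τ ∈ Set.Ioi (0 : ℝ) := hτ.1
    simp only [g, Set.indicator_of_mem hτ, Set.indicator_of_mem hτ']
  · rw [Set.indicator_of_notMem hτ]
    by_cases hτ' : τ ∈ Set.Ioi (0 : ℝ)
    · simp only [g, Set.indicator_of_notMem hτ, Set.indicator_of_mem hτ', zero_mul]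
    · rw [Set.indicator_of_notMem hτ']

/-- A complex functional on `Y^⋄` whose real and imaginary parts are represented by elements of
`Y`. -/
def NormingDualPair.ComplexRepresentable (P : NormingDualPair Y Yd) (φ : Yd → ℂ) : Prop :=
  ∃ z z' : Y, ∀ yd, φ yd = P.pairing yd z + Complex.I * P.pairing yd z'

namespace NormingDualPair.ComplexRepresentable

variable {P : NormingDualPair Y Yd}

theorem add {φ ψ : Yd → ℂ} (hφ : P.ComplexRepresentable φ) (hψ : P.ComplexRepresentable ψ) :
    P.ComplexRepresentable fun yd => φ yd + ψ yd := by
  obtain ⟨z, z', h⟩ := hφ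
  obtain ⟨w, w', h'⟩ := hψ
  refine ⟨z + w, z' + w', fun yd => ?_⟩
  dsimp only
  rw [h, h', map_add, map_add]
  push_cast
  ring

theorem mul_const {φ : Yd → ℂ} (hφ : P.ComplexRepresentable φ) (c : ℂ) :
    P.ComplexRepresentable fun yd => φ yd * c := by
  obtain ⟨z, z', h⟩ := hφ
  refine ⟨c.re • z - c.im • z', c.im • z + c.re • z', fun yd => ?_⟩
  dsimp only
  rw [h]
  apply Complex.ext <;> simp <;> ring

theorem sum {ι : Type*} (s : Finset ι) {φ : ι → Yd → ℂ}
    (hφ : ∀ i, P.ComplexRepresentable (φ i)) :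
    P.ComplexRepresentable fun yd => ∑ i ∈ s, φ i yd := by
  choose z z' h using hφ
  refine ⟨∑ i ∈ s, z i, ∑ i ∈ s, z' i, fun yd => ?_⟩
  simp only [h, map_sum, Complex.ofReal_sum, Finset.sum_add_distrib, Finset.mul_sum]

theorem re {φ : Yd → ℂ} (hφ : P.ComplexRepresentable φ) :
    ∃ z, ∀ yd, (φ yd).re = P.pairing yd z := by
  obtain ⟨z, z', h⟩ := hφ
  exact ⟨z, fun yd => by simp [h]⟩

theorem im {φ : Yd → ℂ} (hφ : P.ComplexRepresentable φ) :
    ∃ z, ∀ yd, (φ yd).im = P.pairing yd z := by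
  obtain ⟨z, z', h⟩ := hφ
  exact ⟨z', fun yd => by simp [h]⟩

end NormingDualPair.ComplexRepresentable

/-! ### The perturbed form -/

section Perturbation

variable {P : NormingDualPair Y Yd} {S₀ : ℝ≥0 → TwinOperator P} {n : ℕ} {M ω : ℝ}

/-- A resolvent as a matrix over the convolution ring. -/
def IsResolventKernel.matrix {k r : ℝ≥0 → Matrix (Fin n) (Fin n) ℝ} (hr : IsResolventKernel k r) :
    Matrix (Fin n) (Fin n) LocallyBoundedMeasurable :=
  Matrix.of fun i j => ⟨fun t => r t i j, hr.measurable i j, fun T =>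
    (hr.locallyBounded T).imp fun _ h t ht => h t ht i j⟩

namespace IsTwinSemigroup

/-- The function `t ↦ y^⋄ S₀(t) y`. -/
def orbit (hS : IsTwinSemigroup S₀) (yd : Yd) (y : Y) : LocallyBoundedMeasurable :=
  ⟨fun t => (S₀ t).form yd y, by
    obtain ⟨M, ω, hM, -⟩ := hS.growth_and_laplace
    exact (hS.expBounded hM yd y).mem⟩

/-- The matrix `q_i^⋄ S₀(t) q_j` over the convolution ring. -/
def kernelMatrix (hS : IsTwinSemigroup S₀) (q : Fin n → Y) (qd : Fin n → Yd) :
    Matrix (Fin n) (Fin n) LocallyBoundedMeasurable :=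
  Matrix.of fun i j => hS.orbit (qd i) (q j)

/-- The row vector `y^⋄ S₀(t) q_j`. -/
def inputRow (hS : IsTwinSemigroup S₀) (q : Fin n → Y) (yd : Yd) :
    Matrix Unit (Fin n) LocallyBoundedMeasurable :=
  Matrix.of fun _ j => hS.orbit yd (q j)

/-- The column vector `q_i^⋄ S₀(t) y`. -/
def outputColumn (hS : IsTwinSemigroup S₀) (qd : Fin n → Yd) (y : Y) :
    Matrix (Fin n) Unit LocallyBoundedMeasurable :=
  Matrix.of fun i _ => hS.orbit (qd i) y

variable {q : Fin n → Y} {qd : Fin n → Yd} {r : ℝ≥0 → Matrix (Fin n) (Fin n) ℝ}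

theorem matrix_eq_left (hS : IsTwinSemigroup S₀)
    (hr : IsResolventKernel (perturbationKernel S₀ q qd) r) :
    hr.matrix = hS.kernelMatrix q qd + hS.kernelMatrix q qd * hr.matrix := by
  ext i j t
  rw [Matrix.add_apply, AddSubgroup.coe_add, Pi.add_apply,
    LocallyBoundedMeasurable.matrix_mul_apply]
  exact congrFun (congrFun (hr.eq_left t) i) j

theorem matrix_eq_right (hS : IsTwinSemigroup S₀)
    (hr : IsResolventKernel (perturbationKernel S₀ q qd) r) :
    hr.matrix = hS.kernelMatrix q qd + hr.matrix * hS.kernelMatrix q qd := by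
  ext i j t
  rw [Matrix.add_apply, AddSubgroup.coe_add, Pi.add_apply,
    LocallyBoundedMeasurable.matrix_mul_apply]
  exact congrFun (congrFun (hr.eq_right t) i) j

theorem exists_exp_resolvent (hS : IsTwinSemigroup S₀) (hM : HasGrowthBound S₀ M ω)
    (q : Fin n → Y) (qd : Fin n → Yd) :
    ∃ r, IsResolventKernel (perturbationKernel S₀ q qd) r ∧
      ∃ B a : ℝ, 0 ≤ B ∧ ω < a ∧ ∀ i j t, |r t i j| ≤ B * Real.exp (a * t) := by
  have hM0 : 0 ≤ M := zero_le_one.trans hM.1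
  obtain ⟨R, h1, h2, B, a, hB, ha, hRB⟩ := LocallyBoundedMeasurable.exists_resolvent
    (k := hS.kernelMatrix q qd) (A := ∑ i, ∑ j, M * ‖q j‖ * ‖qd i‖) (ω := ω) (by positivity) (by
      intro i j t
      refine (hM.2 t (qd i) (q j)).trans ?_
      have h : M * ‖q j‖ * ‖qd i‖ ≤ ∑ i, ∑ j, M * ‖q j‖ * ‖qd i‖ :=
        (Finset.single_le_sum (f := fun j => M * ‖q j‖ * ‖qd i‖) (fun j _ => by positivity)
          (Finset.mem_univ j)).trans
        (Finset.single_le_sum (f := fun i => ∑ j, M * ‖q j‖ * ‖qd i‖) (fun i _ => by positivity)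
          (Finset.mem_univ i))
      calc M * Real.exp (ω * t) * ‖q j‖ * ‖qd i‖
          = M * ‖q j‖ * ‖qd i‖ * Real.exp (ω * t) := by ring
        _ ≤ _ := mul_le_mul_of_nonneg_right h (Real.exp_pos _).le)
  refine ⟨fun t => Matrix.of fun i j => (R i j).1 t, ⟨fun i j => (R i j).2.1, fun T => ?_,
    fun t => ?_, fun t => ?_⟩, B, a, hB, ha, hRB⟩
  · refine ⟨B * Real.exp (|a| * T), fun t ht i j => (hRB i j t).trans ?_⟩
    exact mul_le_mul_of_nonneg_left (Real.exp_le_exp.2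
      (mul_le_mul (le_abs_self a) (by exact_mod_cast ht) t.coe_nonneg (abs_nonneg a))) hB
  · ext i j
    have := congrArg (fun A => (A i j).1 t) h1
    simp only [Matrix.add_apply, AddSubgroup.coe_add, Pi.add_apply,
      LocallyBoundedMeasurable.matrix_mul_apply] at this
    exact this
  · ext i j
    have := congrArg (fun A => (A i j).1 t) h2
    simp only [Matrix.add_apply, AddSubgroup.coe_add, Pi.add_apply,
      LocallyBoundedMeasurable.matrix_mul_apply] at this
    exact this

theorem resolvent_unique (hS : IsTwinSemigroup S₀) {r' : ℝ≥0 → Matrix (Fin n) (Fin n) ℝ}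
    (hr : IsResolventKernel (perturbationKernel S₀ q qd) r)
    (hr' : IsResolventKernel (perturbationKernel S₀ q qd) r') : r = r' := by
  have h := LocallyBoundedMeasurable.resolvent_unique (hS.matrix_eq_right hr)
    (hS.matrix_eq_left hr')
  ext t i j
  exact congrArg (fun A : Matrix (Fin n) (Fin n) LocallyBoundedMeasurable => (A i j).1 t) h

theorem outputFunction_eq (hS : IsTwinSemigroup S₀)
    (hr : IsResolventKernel (perturbationKernel S₀ q qd) r) (y : Y) (i : Fin n) :
    outputFunction S₀ qd r y i =
      ((hS.outputColumn qd y + hr.matrix * hS.outputColumn qd y) i ()).1 := by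
  ext t
  rw [Matrix.add_apply, AddSubgroup.coe_add, Pi.add_apply,
    LocallyBoundedMeasurable.matrix_mul_apply]
  rfl

theorem inputFunction_eq (hS : IsTwinSemigroup S₀)
    (hr : IsResolventKernel (perturbationKernel S₀ q qd) r) (yd : Yd) (j : Fin n) :
    inputFunction S₀ q r yd j = ((hS.inputRow q yd + hS.inputRow q yd * hr.matrix) () j).1 := by
  ext t
  rw [Matrix.add_apply, AddSubgroup.coe_add, Pi.add_apply,
    LocallyBoundedMeasurable.matrix_mul_apply]
  rfl

theorem outputFunction_mem (hS : IsTwinSemigroup S₀)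
    (hr : IsResolventKernel (perturbationKernel S₀ q qd) r) (y : Y) (i : Fin n) :
    outputFunction S₀ qd r y i ∈ LocallyBoundedMeasurable := by
  rw [hS.outputFunction_eq hr]
  exact Subtype.property _

theorem inputFunction_mem (hS : IsTwinSemigroup S₀)
    (hr : IsResolventKernel (perturbationKernel S₀ q qd) r) (yd : Yd) (j : Fin n) :
    inputFunction S₀ q r yd j ∈ LocallyBoundedMeasurable := by
  rw [hS.inputFunction_eq hr]
  exact Subtype.property _

theorem perturbedForm_eq (hS : IsTwinSemigroup S₀)
    (hr : IsResolventKernel (perturbationKernel S₀ q qd) r) (t : ℝ≥0) (yd : Yd) (y : Y) :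
    perturbedForm S₀ q qd r t yd y = (S₀ t).form yd y + ((hS.inputRow q yd *
      (hS.outputColumn qd y + hr.matrix * hS.outputColumn qd y)) () ()).1 t := by
  rw [LocallyBoundedMeasurable.matrix_mul_apply, perturbedForm]
  simp only [hS.outputFunction_eq hr]
  rfl

theorem perturbedFormDual_eq (hS : IsTwinSemigroup S₀)
    (hr : IsResolventKernel (perturbationKernel S₀ q qd) r) (t : ℝ≥0) (yd : Yd) (y : Y) :
    perturbedFormDual S₀ q qd r t yd y = (S₀ t).form yd y +
      (((hS.inputRow q yd + hS.inputRow q yd * hr.matrix) * hS.outputColumn qd y) () ()).1 t := by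
  rw [LocallyBoundedMeasurable.matrix_mul_apply, perturbedFormDual]
  simp only [hS.inputFunction_eq hr]
  rfl

/-- The two expressions for the perturbed form agree by associativity of convolution. -/
theorem perturbedForm_eq_dual (hS : IsTwinSemigroup S₀)
    (hr : IsResolventKernel (perturbationKernel S₀ q qd) r) (t : ℝ≥0) (yd : Yd) (y : Y) :
    perturbedForm S₀ q qd r t yd y = perturbedFormDual S₀ q qd r t yd y := by
  rw [hS.perturbedForm_eq hr, hS.perturbedFormDual_eq hr, Matrix.mul_add, Matrix.add_mul,
    Matrix.mul_assoc]

/-- `v_i(t) y = q_i^⋄ S(t) y`, because `v = a + r * a` solves `v = a + k * v`. -/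
theorem perturbedForm_output (hS : IsTwinSemigroup S₀)
    (hr : IsResolventKernel (perturbationKernel S₀ q qd) r) (t : ℝ≥0) (i : Fin n) (y : Y) :
    perturbedForm S₀ q qd r t (qd i) y = outputFunction S₀ qd r y i t := by
  have h : hS.outputColumn qd y + hr.matrix * hS.outputColumn qd y = hS.outputColumn qd y +
      hS.kernelMatrix q qd * (hS.outputColumn qd y + hr.matrix * hS.outputColumn qd y) := by
    conv_lhs => rw [hS.matrix_eq_left hr]
    rw [Matrix.mul_add, Matrix.add_mul, Matrix.mul_assoc]
  rw [hS.outputFunction_eq hr, h, Matrix.add_apply, AddSubgroup.coe_add, Pi.add_apply,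
    hS.perturbedForm_eq hr, LocallyBoundedMeasurable.matrix_mul_apply,
    LocallyBoundedMeasurable.matrix_mul_apply]
  rfl

/-- `y^⋄ w_j(t) = y^⋄ S(t) q_j`, because `w = b + b * r` solves `w = b + w * k`. -/
theorem perturbedFormDual_input (hS : IsTwinSemigroup S₀)
    (hr : IsResolventKernel (perturbationKernel S₀ q qd) r) (t : ℝ≥0) (yd : Yd) (j : Fin n) :
    perturbedFormDual S₀ q qd r t yd (q j) = inputFunction S₀ q r yd j t := by
  have h : hS.inputRow q yd + hS.inputRow q yd * hr.matrix = hS.inputRow q yd +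
      (hS.inputRow q yd + hS.inputRow q yd * hr.matrix) * hS.kernelMatrix q qd := by
    conv_lhs => rw [hS.matrix_eq_right hr]
    rw [Matrix.mul_add, Matrix.add_mul, Matrix.mul_assoc]
  rw [hS.inputFunction_eq hr, h, Matrix.add_apply, AddSubgroup.coe_add, Pi.add_apply,
    hS.perturbedFormDual_eq hr, LocallyBoundedMeasurable.matrix_mul_apply,
    LocallyBoundedMeasurable.matrix_mul_apply]
  rfl

theorem perturbedForm_mem (hS : IsTwinSemigroup S₀)
    (hr : IsResolventKernel (perturbationKernel S₀ q qd) r) (yd : Yd) (y : Y) :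
    (fun t => perturbedForm S₀ q qd r t yd y) ∈ LocallyBoundedMeasurable := by
  simp only [hS.perturbedForm_eq hr]
  exact LocallyBoundedMeasurable.add_mem (hS.orbit yd y).2 (Subtype.property _)

/-- The translation identity for the perturbed form; `x` plays the role of `S(s) y`. -/
theorem perturbedForm_add (hS : IsTwinSemigroup S₀)
    (hr : IsResolventKernel (perturbationKernel S₀ q qd) r) (s : ℝ≥0) {x y : Y}
    (hx : ∀ yd, P.pairing yd x = perturbedForm S₀ q qd r s yd y) (t : ℝ≥0) (yd : Yd) :
    perturbedForm S₀ q qd r (t + s) yd y = perturbedForm S₀ q qd r t yd x := by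
  have hshift : ∀ (t : ℝ≥0) (yd : Yd), perturbedForm S₀ q qd r (t + s) yd y =
      (S₀ t).form yd x + ∑ j, convolve (fun τ => (S₀ τ).form yd (q j))
        (fun τ => outputFunction S₀ qd r y j (s + τ)) t := by
    intro t yd
    rw [← TwinOperator.pairing_coact, hx, perturbedForm, perturbedForm, hS.form_coact, add_assoc,
      ← Finset.sum_add_distrib]
    congr 1
    refine Finset.sum_congr rfl fun j _ => ?_
    rw [convolve_add_apply (f := fun τ => (S₀ τ).form yd (q j)) (hS.orbit yd (q j)).2
      (hS.outputFunction_mem hr y j)]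
    simp only [hS.form_coact]
  -- `u = v(s + ·) y` solves the same Volterra equation as `v(·) x`.
  let u : Matrix (Fin n) Unit LocallyBoundedMeasurable := Matrix.of fun i _ =>
    ⟨fun t => outputFunction S₀ qd r y i (s + t),
      LocallyBoundedMeasurable.shift_mem (hS.outputFunction_mem hr y i) s⟩
  have hu : u = hS.outputColumn qd x + hS.kernelMatrix q qd * u := by
    ext i j t
    rw [Matrix.add_apply, AddSubgroup.coe_add, Pi.add_apply,
      LocallyBoundedMeasurable.matrix_mul_apply]
    refine Eq.trans ?_ (hshift t (qd i))
    rw [hS.perturbedForm_output hr, add_comm]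
    rfl
  have hu' := LocallyBoundedMeasurable.volterra_unique (hS.matrix_eq_right hr) hu
  have hu'' : ∀ j, (fun t => outputFunction S₀ qd r y j (s + t)) = outputFunction S₀ qd r x j := by
    intro j
    rw [hS.outputFunction_eq hr x, ← hu']
    rfl
  rw [hshift, perturbedForm]
  simp only [hu'']

/-- The perturbed form inherits an exponential bound from the unperturbed semigroup and the
resolvent. -/
theorem abs_perturbedForm_le (hS : IsTwinSemigroup S₀) (hM : HasGrowthBound S₀ M ω)
    (hr : IsResolventKernel (perturbationKernel S₀ q qd) r) :
    ∃ M' a : ℝ, 1 ≤ M' ∧ ω < a ∧ ∀ t yd y,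
      |perturbedForm S₀ q qd r t yd y| ≤ M' * Real.exp (a * t) * ‖y‖ * ‖yd‖ := by
  obtain ⟨r', hr', B, a, hB, ha, hrB⟩ := hS.exists_exp_resolvent hM q qd
  rw [← hS.resolvent_unique hr hr'] at hrB
  have hM0 : 0 ≤ M := zero_le_one.trans hM.1
  have hd : 0 < a - ω := sub_pos.2 ha
  have hexp : ∀ t : ℝ≥0, Real.exp (ω * t) ≤ Real.exp (a * t) := fun t =>
    Real.exp_le_exp.2 (mul_le_mul_of_nonneg_right ha.le t.coe_nonneg)
  let D : Fin n → ℝ := fun i => M * ‖qd i‖ + ∑ j, M * ‖qd j‖ * B / (a - ω)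
  have hv : ∀ y i t, |outputFunction S₀ qd r y i t| ≤ D i * ‖y‖ * Real.exp (a * t) := by
    intro y i t
    have h1 : ∀ (t : ℝ≥0) j, |(S₀ t).form (qd j) y| ≤ M * ‖qd j‖ * ‖y‖ * Real.exp (ω * t) :=
      fun t j => (hM.2 t _ _).trans (le_of_eq (by ring))
    calc |outputFunction S₀ qd r y i t|
        ≤ M * ‖qd i‖ * ‖y‖ * Real.exp (a * t) +
          ∑ j, M * ‖qd j‖ * ‖y‖ * B / (a - ω) * Real.exp (a * t) := by
          refine (abs_add_le _ _).trans (add_le_add ((h1 t i).trans ?_)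
            ((Finset.abs_sum_le_sum_abs _ _).trans (Finset.sum_le_sum fun j _ => ?_)))
          · exact mul_le_mul_of_nonneg_left (hexp t) (by positivity)
          · rw [convolve_comm]
            exact abs_convolve_le_exp ha (fun t => h1 t j) (hrB i j) t
      _ = D i * ‖y‖ * Real.exp (a * t) := by
          simp only [D, add_mul, Finset.sum_mul]
          congr 1
          refine Finset.sum_congr rfl fun j _ => ?_
          ring
  refine ⟨max 1 (M + ∑ j, M * ‖q j‖ * D j / (a - ω)), a, le_max_left _ _, ha, fun t yd y => ?_⟩
  have h2 : ∀ (t : ℝ≥0) j, |(S₀ t).form yd (q j)| ≤ M * ‖q j‖ * ‖yd‖ * Real.exp (ω * t) :=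
    fun t j => (hM.2 t _ _).trans (le_of_eq (by ring))
  calc |perturbedForm S₀ q qd r t yd y|
      ≤ M * Real.exp (a * t) * ‖y‖ * ‖yd‖ +
        ∑ j, M * ‖q j‖ * ‖yd‖ * (D j * ‖y‖) / (a - ω) * Real.exp (a * t) := by
        refine (abs_add_le _ _).trans (add_le_add ((hM.2 t _ _).trans ?_)
          ((Finset.abs_sum_le_sum_abs _ _).trans (Finset.sum_le_sum fun j _ => ?_)))
        · have := hexp t
          gcongr
        · exact abs_convolve_le_exp ha (fun t => h2 t j) (fun t => hv y j t) t
    _ = (M + ∑ j, M * ‖q j‖ * D j / (a - ω)) * Real.exp (a * t) * ‖y‖ * ‖yd‖ := by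
        simp only [add_mul, Finset.sum_mul]
        congr 1
        refine Finset.sum_congr rfl fun j _ => ?_
        ring
    _ ≤ max 1 (M + ∑ j, M * ‖q j‖ * D j / (a - ω)) * Real.exp (a * t) * ‖y‖ * ‖yd‖ := by
        gcongr
        exact le_max_right _ _

end IsTwinSemigroup

end Perturbation

end DualPair

/-! ### The perturbed semigroup and its generator -/

section PerturbedSemigroup

variable {Y Yd : Type*} [NormedAddCommGroup Y] [NormedSpace ℝ Y]
  [NormedAddCommGroup Yd] [NormedSpace ℝ Yd] {P : NormingDualPair Y Yd}
  {S₀ : ℝ≥0 → TwinOperator P} {n : ℕ} {q : Fin n → Y} {qd : Fin n → Yd}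
  {r : ℝ≥0 → Matrix (Fin n) (Fin n) ℝ}

namespace IsTwinSemigroup

/-- The form `S(t)` is a twin operator: its first expression is represented in `Y`, its second
expression is represented in `Y^⋄`. -/
theorem exists_perturbed_twinOperator [CompleteSpace Y] [CompleteSpace Yd]
    (hS : IsTwinSemigroup S₀) (hr : IsResolventKernel (perturbationKernel S₀ q qd) r) (t : ℝ≥0) :
    ∃ T : TwinOperator P, ∀ yd y, T.form yd y = perturbedForm S₀ q qd r t yd y := by
  obtain ⟨M, ω, hM, hlap⟩ := hS.growth_and_laplace
  have hlap' : ∀ l > ω, ∃ R, IsLaplaceTransform S₀ l R := fun l hl => by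
    obtain ⟨R, J, h⟩ := hlap l (by simpa using hl)
    exact ⟨R, h.isLaplaceTransform⟩
  refine ⟨TwinOperator.ofRepresentable (fun yd y => perturbedForm S₀ q qd r t yd y)
    (fun y => ?_) (fun yd => ?_) ?_, fun yd y => rfl⟩
  · have h : ∀ j, ∃ z, ∀ yd, convolve (outputFunction S₀ qd r y j)
        (fun τ => (S₀ τ).form yd (q j)) t = P.pairing yd z := fun j =>
      P.exists_pairing_eq_convolve (s := fun τ yd => (S₀ τ).form yd (q j)) (C := M * ‖q j‖)
        (fun yd => hS.measurable yd _)
        (fun t yd => (hM.2 t yd _).trans (le_of_eq (by ring)))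
        (fun l hl => by
          obtain ⟨R, hR⟩ := hlap' l hl
          exact ⟨R.act (q j), fun yd => (R.pairing_act yd _).trans (hR yd _)⟩)
        (hS.outputFunction_mem hr y j) t
    choose z hz using h
    refine ⟨(S₀ t).act y + ∑ j, z j, fun yd => ?_⟩
    rw [LinearMap.map_add, map_sum, TwinOperator.pairing_act, perturbedForm]
    simp only [← hz, convolve_comm (outputFunction S₀ qd r y _)]
  · have h : ∀ j, ∃ z, ∀ y, convolve (inputFunction S₀ q r yd j)
        (fun τ => (S₀ τ).form (qd j) y) t = P.flip.pairing y z := fun j =>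
      P.flip.exists_pairing_eq_convolve (s := fun τ y => (S₀ τ).form (qd j) y) (C := M * ‖qd j‖)
        (fun y => hS.measurable _ y)
        (fun t y => (hM.2 t _ y).trans (le_of_eq (by ring)))
        (fun l hl => by
          obtain ⟨R, hR⟩ := hlap' l hl
          exact ⟨R.coact (qd j), fun y => (R.pairing_coact _ y).trans (hR _ y)⟩)
        (hS.inputFunction_mem hr yd j) t
    choose z hz using h
    refine ⟨(S₀ t).coact yd + ∑ j, z j, fun y => ?_⟩
    rw [hS.perturbedForm_eq_dual hr, LinearMap.map_add, map_sum, LinearMap.add_apply,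
      LinearMap.sum_apply, TwinOperator.pairing_coact, perturbedFormDual]
    simp only [hz]
    rfl
  · obtain ⟨M', a, hM', -, hb⟩ := hS.abs_perturbedForm_le hM hr
    exact ⟨M' * Real.exp (a * t), by positivity, fun yd y =>
      (hb t yd y).trans (le_of_eq (by ring))⟩

/-- Exponential bounds for all the functions entering the convolutions. -/
theorem exists_expBounded (hS : IsTwinSemigroup S₀) {M ω : ℝ} (hM : HasGrowthBound S₀ M ω)
    (hr : IsResolventKernel (perturbationKernel S₀ q qd) r) :
    ∃ M' a : ℝ, 1 ≤ M' ∧ ω < a ∧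
      (∀ t yd y, |perturbedForm S₀ q qd r t yd y| ≤ M' * Real.exp (a * t) * ‖y‖ * ‖yd‖) ∧
      (∀ yd y, ExpBounded a fun t => (S₀ t).form yd y) ∧
      (∀ yd y, ExpBounded a fun t => perturbedForm S₀ q qd r t yd y) ∧
      (∀ y i, ExpBounded a (outputFunction S₀ qd r y i)) ∧
      ∀ yd j, ExpBounded a (inputFunction S₀ q r yd j) := by
  obtain ⟨M', a, hM', ha, hb⟩ := hS.abs_perturbedForm_le hM hr
  have h : ∀ yd y, ExpBounded a fun t => perturbedForm S₀ q qd r t yd y := fun yd y =>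
    ⟨(hS.perturbedForm_mem hr yd y).1, M' * ‖y‖ * ‖yd‖, fun t =>
      (hb t yd y).trans (le_of_eq (by ring))⟩
  refine ⟨M', a, hM', ha, hb, fun yd y => (hS.expBounded hM yd y).mono ha.le, h,
    fun y i => ?_, fun yd j => ?_⟩
  · have := h (qd i) y
    simp only [hS.perturbedForm_output hr] at this
    exact this
  · have := h yd (q j)
    simp only [hS.perturbedForm_eq_dual hr, hS.perturbedFormDual_input hr] at this
    exact this

/-- The perturbation formula on the level of Laplace transforms. -/
theorem laplace_perturbedForm (hS : IsTwinSemigroup S₀) {M ω a : ℝ}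
    (hM : HasGrowthBound S₀ M ω) (ha : ω < a)
    (hv : ∀ y i, ExpBounded a (outputFunction S₀ qd r y i)) (yd : Yd) (y : Y) {z : ℂ}
    (hz : a < z.re) :
    laplace (fun t => perturbedForm S₀ q qd r t yd y) z =
      laplace (fun t => (S₀ t).form yd y) z +
        ∑ j, laplace (fun t => (S₀ t).form yd (q j)) z *
          laplace (outputFunction S₀ qd r y j) z := by
  have h0 := fun yd y => hS.expBounded hM yd y
  have hc : ∀ j, ExpBounded a (convolve (fun τ => (S₀ τ).form yd (q j))
      (outputFunction S₀ qd r y j)) := fun j => (h0 yd (q j)).convolve (hv y j) ha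
  have hsum : ExpBounded a fun t => ∑ j, convolve (fun τ => (S₀ τ).form yd (q j))
      (outputFunction S₀ qd r y j) t := by
    refine ⟨Finset.measurable_fun_sum _ fun j _ => (hc j).1, ?_⟩
    choose C hC using fun j => (hc j).2
    refine ⟨∑ j, C j, fun t => (Finset.abs_sum_le_sum_abs _ _).trans ?_⟩
    rw [Finset.sum_mul]
    exact Finset.sum_le_sum fun j _ => hC j t
  simp only [perturbedForm]
  rw [laplace_add ((h0 yd y).mono ha.le) hsum hz, laplace_sum _ hc hz]
  congr 1
  exact Finset.sum_congr rfl fun j _ => laplace_convolve ((h0 _ _).mono ha.le) (hv y j) hz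

theorem laplace_perturbedFormDual (hS : IsTwinSemigroup S₀) {M ω a : ℝ}
    (hM : HasGrowthBound S₀ M ω) (ha : ω < a)
    (hw : ∀ yd j, ExpBounded a (inputFunction S₀ q r yd j)) (yd : Yd) (y : Y) {z : ℂ}
    (hz : a < z.re) :
    laplace (fun t => perturbedFormDual S₀ q qd r t yd y) z =
      laplace (fun t => (S₀ t).form yd y) z +
        ∑ j, laplace (inputFunction S₀ q r yd j) z *
          laplace (fun t => (S₀ t).form (qd j) y) z := by
  have h0 := fun yd y => hS.expBounded hM yd y
  have hc : ∀ j, ExpBounded a (convolve (inputFunction S₀ q r yd j)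
      (fun τ => (S₀ τ).form (qd j) y)) := fun j => by
    rw [convolve_comm]
    exact (h0 _ _).convolve (hw yd j) ha
  have hsum : ExpBounded a fun t => ∑ j, convolve (inputFunction S₀ q r yd j)
      (fun τ => (S₀ τ).form (qd j) y) t := by
    refine ⟨Finset.measurable_fun_sum _ fun j _ => (hc j).1, ?_⟩
    choose C hC using fun j => (hc j).2
    refine ⟨∑ j, C j, fun t => (Finset.abs_sum_le_sum_abs _ _).trans ?_⟩
    rw [Finset.sum_mul]
    exact Finset.sum_le_sum fun j _ => hC j t
  simp only [perturbedFormDual]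
  rw [laplace_add ((h0 yd y).mono ha.le) hsum hz, laplace_sum _ hc hz]
  congr 1
  exact Finset.sum_congr rfl fun j _ => laplace_convolve (hw yd j) ((h0 _ _).mono ha.le) hz

variable {S : ℝ≥0 → TwinOperator P}

theorem perturbed (hS : IsTwinSemigroup S₀)
    (hr : IsResolventKernel (perturbationKernel S₀ q qd) r)
    (hT : ∀ t yd y, (S t).form yd y = perturbedForm S₀ q qd r t yd y) : IsTwinSemigroup S := by
  refine ⟨fun yd y => ?_, fun t s yd y => ?_, fun yd y => ?_, ?_⟩
  · simp only [hT, perturbedForm, convolve_apply_zero, hS.map_zero, Finset.sum_const_zero, add_zero]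
  · rw [TwinOperator.pairing_coact, hT, hT]
    exact hS.perturbedForm_add hr s (fun yd => (TwinOperator.pairing_act _ _ _).trans (hT s yd y))
      t yd
  · simp only [hT]
    exact (hS.perturbedForm_mem hr yd y).1
  · obtain ⟨M, ω, hM, hlap⟩ := hS.growth_and_laplace
    obtain ⟨M', a, hM', ha, hb, h0, hp, hv, hw⟩ := hS.exists_expBounded hM hr
    refine ⟨M', a, ⟨hM', fun t yd y => by rw [hT]; exact hb t yd y⟩, fun z hz => ?_⟩
    obtain ⟨R₀, J₀, hRJ⟩ := hlap z (ha.trans hz)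
    let Φ : Yd → Y → ℂ := fun yd y => laplace (fun t => perturbedForm S₀ q qd r t yd y) z
    have hrep0 : ∀ y, P.ComplexRepresentable fun yd => laplace (fun t => (S₀ t).form yd y) z :=
      fun y => ⟨R₀.act y, J₀.act y, fun yd => by
        rw [TwinOperator.pairing_act, TwinOperator.pairing_act]
        exact (hRJ yd y).symm⟩
    have hrep0' : ∀ yd, P.flip.ComplexRepresentable fun y =>
        laplace (fun t => (S₀ t).form yd y) z :=
      fun yd => ⟨R₀.coact yd, J₀.coact yd, fun y => by
        change _ = (P.pairing (R₀.coact yd) y : ℂ) + Complex.I * (P.pairing (J₀.coact yd) y : ℂ)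
        rw [TwinOperator.pairing_coact, TwinOperator.pairing_coact]
        exact (hRJ yd y).symm⟩
    have hrep : ∀ y, P.ComplexRepresentable fun yd => Φ yd y := fun y => by
      simp only [Φ, hS.laplace_perturbedForm hM ha hv _ y hz]
      exact (hrep0 y).add (.sum _ fun j => (hrep0 (q j)).mul_const _)
    have hrep' : ∀ yd, P.flip.ComplexRepresentable fun y => Φ yd y := fun yd => by
      simp only [Φ, hS.perturbedForm_eq_dual hr, hS.laplace_perturbedFormDual hM ha hw yd _ hz,
        mul_comm (laplace (inputFunction S₀ q r yd _) z)]
      exact (hrep0' yd).add (.sum _ fun j => (hrep0' (qd j)).mul_const _)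
    obtain ⟨K, hK, hΦ⟩ : ∃ K : ℝ, 0 < K ∧ ∀ yd y, ‖Φ yd y‖ ≤ K * ‖yd‖ * ‖y‖ := by
      have hi := integrableOn_exp_mul_Ioi (sub_neg.2 hz) 0
      refine ⟨M' * ((∫ t in Set.Ioi (0 : ℝ), Real.exp ((a - z.re) * t)) + 1), ?_, fun yd y => ?_⟩
      · have : 0 ≤ ∫ t in Set.Ioi (0 : ℝ), Real.exp ((a - z.re) * t) :=
          integral_nonneg fun t => (Real.exp_pos _).le
        positivity
      · refine (norm_integral_le_of_norm_le (hi.const_mul (M' * ‖yd‖ * ‖y‖))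
          ((ae_restrict_iff' measurableSet_Ioi).2 (Eventually.of_forall fun t ht => ?_))).trans ?_
        · rw [norm_mul, Complex.norm_exp, Complex.norm_real, Real.norm_eq_abs]
          have h1 : (-z * (t : ℂ)).re = -z.re * t := by simp
          have h2 := hb t.toNNReal yd y
          rw [Real.coe_toNNReal _ (le_of_lt ht)] at h2
          rw [h1]
          refine (mul_le_mul_of_nonneg_left h2 (Real.exp_pos _).le).trans (le_of_eq ?_)
          have h3 : Real.exp ((a - z.re) * t) = Real.exp (-z.re * t) * Real.exp (a * t) := by
            rw [← Real.exp_add]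
            ring_nf
          rw [h3]
          ring
        · rw [integral_const_mul]
          have : 0 ≤ M' * ‖yd‖ * ‖y‖ := by positivity
          nlinarith
    refine ⟨TwinOperator.ofRepresentable (fun yd y => (Φ yd y).re) (fun y => (hrep y).re)
        (fun yd => (hrep' yd).re)
        ⟨K, hK, fun yd y => (Complex.abs_re_le_norm _).trans (hΦ yd y)⟩,
      TwinOperator.ofRepresentable (fun yd y => (Φ yd y).im) (fun y => (hrep y).im)
        (fun yd => (hrep' yd).im)
        ⟨K, hK, fun yd y => (Complex.abs_im_le_norm _).trans (hΦ yd y)⟩, fun yd y => ?_⟩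
    simp only [hT]
    change ((Φ yd y).re : ℂ) + Complex.I * ((Φ yd y).im : ℂ) = Φ yd y
    rw [mul_comm, Complex.re_add_im]

/-- With `R₀`, `R` the Laplace transforms of `S₀`, `S` at a large real number, the perturbation
formulas `R y = R₀ y + ∑ ⟨q_j^⋄, R y⟩ R₀ q_j` and `R y = R₀ y + ∑ ⟨q_j^⋄, R₀ y⟩ R q_j` turn solutions
of `y = R (l y - z)` into solutions of `y = R₀ (l y - z₀)` and conversely. -/
theorem generatorGraph_perturbed (hS : IsTwinSemigroup S₀)
    (hr : IsResolventKernel (perturbationKernel S₀ q qd) r)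
    (hT : ∀ t yd y, (S t).form yd y = perturbedForm S₀ q qd r t yd y) :
    generatorGraph S = finiteRankPerturbation P (generatorGraph S₀) q qd := by
  have hTS := hS.perturbed hr hT
  obtain ⟨M, ω, hM, hlap⟩ := hS.growth_and_laplace
  obtain ⟨N, b, hN, hlapS⟩ := hTS.growth_and_laplace
  obtain ⟨M', a, hM', ha, hb, h0, hp, hv, hw⟩ := hS.exists_expBounded hM hr
  obtain ⟨l, hl⟩ := exists_gt (max a b)
  have hal : a < l := (le_max_left _ _).trans_lt hl
  have hbl : b < l := (le_max_right _ _).trans_lt hl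
  have hωl : ω < l := ha.trans hal
  obtain ⟨R₀, J₀, hRJ₀⟩ := hlap l (by simpa using hωl)
  obtain ⟨R, J, hRJ⟩ := hlapS l (by simpa using hbl)
  have hR₀ := hRJ₀.isLaplaceTransform
  have hR := hRJ.isLaplaceTransform
  have hzl : a < (l : ℂ).re := by simpa using hal
  have h1 : ∀ yd y, R.form yd y =
      R₀.form yd y + ∑ j, R₀.form yd (q j) * R.form (qd j) y := by
    intro yd y
    have h := hS.laplace_perturbedForm (q := q) hM ha hv yd y hzl
    have hvj : ∀ j, outputFunction S₀ qd r y j = fun t => (S t).form (qd j) y := fun j => by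
      ext t
      rw [hT, hS.perturbedForm_output hr]
    simp only [← hT, hvj, ← hR.form_eq, ← hR₀.form_eq] at h
    exact_mod_cast h
  have h2 : ∀ yd y, R.form yd y =
      R₀.form yd y + ∑ j, R.form yd (q j) * R₀.form (qd j) y := by
    intro yd y
    have h := hS.laplace_perturbedFormDual (qd := qd) hM ha hw yd y hzl
    have hwj : ∀ j, inputFunction S₀ q r yd j = fun t => (S t).form yd (q j) := fun j => by
      ext t
      rw [hT, hS.perturbedForm_eq_dual hr, hS.perturbedFormDual_input hr]
    simp only [← hS.perturbedForm_eq_dual hr, ← hT, hwj, ← hR.form_eq, ← hR₀.form_eq] at h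
    exact_mod_cast h
  ext ⟨y, z⟩
  constructor
  · intro hyz
    have hy : y = R.act (l • y - z) := hTS.eq_act_of_mem_generatorGraph hyz hN hbl hR
    refine ⟨z - ∑ j, P.pairing (qd j) y • q j, ⟨M, ω, l, R₀, hM, hωl, hR₀,
      P.pairing_ext fun yd => ?_⟩, (sub_add_cancel _ _).symm⟩
    have h3 := h1 yd (l • y - z)
    simp only [← R.pairing_act, ← hy] at h3
    dsimp only
    rw [h3, R₀.pairing_act, ← sub_add, LinearMap.map_add, map_sum]
    congr 1
    refine Finset.sum_congr rfl fun j _ => ?_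
    rw [LinearMap.map_smul, smul_eq_mul, mul_comm]
  · rintro ⟨z₀, hyz, hz⟩
    have hy : y = R₀.act (l • y - z₀) := hS.eq_act_of_mem_generatorGraph hyz hM hωl hR₀
    refine ⟨N, b, l, R, hN, hbl, hR, P.pairing_ext fun yd => ?_⟩
    dsimp only at hz ⊢
    have h3 := h2 yd (l • y - z₀)
    simp only [← R₀.pairing_act, ← hy] at h3
    rw [R.pairing_act, hz, ← sub_sub, LinearMap.map_sub, h3, map_sum, add_sub_assoc,
      left_eq_add, sub_eq_zero]
    refine Finset.sum_congr rfl fun j _ => ?_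
    rw [LinearMap.map_smul, smul_eq_mul, mul_comm]

end IsTwinSemigroup

end PerturbedSemigroup

end

theorem theorem5p1 {Y Yd : Type*} [NormedAddCommGroup Y] [NormedSpace ℝ Y] [CompleteSpace Y]
    [NormedAddCommGroup Yd] [NormedSpace ℝ Yd] [CompleteSpace Yd]
    (P : NormingDualPair Y Yd) (hP : P.SuitableForTwinPerturbation)
    (S₀ : ℝ≥0 → TwinOperator P) (hS₀ : IsTwinSemigroup S₀)
    {n : ℕ} (q : Fin n → Y) (qd : Fin n → Yd) :
    (∃! r : ℝ≥0 → Matrix (Fin n) (Fin n) ℝ,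
      IsResolventKernel (perturbationKernel S₀ q qd) r) ∧
    ∀ r : ℝ≥0 → Matrix (Fin n) (Fin n) ℝ, IsResolventKernel (perturbationKernel S₀ q qd) r →
      (∀ (t : ℝ≥0) (yd : Yd) (y : Y),
        perturbedForm S₀ q qd r t yd y = perturbedFormDual S₀ q qd r t yd y) ∧
      ∃ S : ℝ≥0 → TwinOperator P,
        (∀ (t : ℝ≥0) (yd : Yd) (y : Y), (S t).form yd y = perturbedForm S₀ q qd r t yd y) ∧
        IsTwinSemigroup S ∧
        generatorGraph S = finiteRankPerturbation P (generatorGraph S₀) q qd := by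
  constructor
  · obtain ⟨M, ω, hM, -⟩ := hS₀.growth_and_laplace
    obtain ⟨r, hr, -⟩ := hS₀.exists_exp_resolvent hM q qd
    exact ⟨r, hr, fun r' hr' => hS₀.resolvent_unique hr' hr⟩
  · intro r hr
    refine ⟨hS₀.perturbedForm_eq_dual hr, ?_⟩
    choose S hT using hS₀.exists_perturbed_twinOperator hr
    exact ⟨S, hT, hS₀.perturbed hr hT, hS₀.generatorGraph_perturbed hr hT⟩
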